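/- **Proposition.** Let $(N,\xi)$ be a closed connected contact manifold of dimension $2n+1$, co-oriented by a global contact form $\alpha$, $\xi=\ker\alpha$, and let $\mathrm{Cont}_0(N,\xi)$ be the group of (co-orientation preserving) contactomorphisms of $(N,\xi)$ that are isotopic to the identity through contactomorphisms. For a smooth contact isotopy $\{\psi_t\}_{t\in[0,1]}$, $\psi_0=1$, let $H_t=\alpha(Y_t)$ be its contact Hamiltonian, where $Y_t=\frac{d}{dt'}\big|_{t'=t}\psi_{t'}\circ\psi_t^{-1}$. For $\psi\in\mathrm{Cont}_0(N,\xi)$ put $$|\psi|_\alpha=\inf\int_0^1\max_N|H_t|\,dt,\qquad |\psi|^{\mathrm{osc}}_\alpha=\inf\int_0^1\bigl(\max_N H_t-\min_N H_t\bigr)\,dt,$$ both infima being over all contact isotopies $\{\psi_t\}_{t\in[0,1]}$ with $\psi_0=1$, $\psi_1=\psi$, and put $d_\alpha(\phi,\psi)=|\psi\phi^{-1}|_\alpha$. Let $\mathcal R=\{\phi_R^t\mid t\in\mathbb R\}$ be the flow of the Reeb vector field $R$ of $\alpha$ ($\alpha(R)=1$, $\iota_R d\alpha=0$), and let $d_\alpha(\psi,\mathcal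 R)=\inf_{\rho\in\mathcal R}d_\alpha(\psi,\rho)$. Then for every $\psi\in\mathrm{Cont}_0(N,\xi)$ $$\tfrac12|\psi|^{\mathrm{osc}}_\alpha=d_\alpha(\psi,\mathcal R)=\inf_{t\in\mathbb R}d_\alpha(\psi,\phi_R^t).$$ -/

import Mathlib

open scoped Manifold ContDiff

noncomputable section

/-- The Euclidean model space of dimension `2n+1`. -/
abbrev OddModel (n : ℕ) : Type := EuclideanSpace ℝ (Fin (2 * n + 1))

variable {n : ℕ} {N : Type*} [TopologicalSpace N] [ChartedSpace (OddModel n) N]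

/-- The differential 1-form `α` read in the chart around `x₀`, i.e. the pullback of `α` under the
inverse of that chart. -/
def oneFormInChart (α : ∀ x : N, TangentSpace (𝓡 (2 * n + 1)) x →L[ℝ] ℝ) (x₀ : N)
    (y : OddModel n) : OddModel n →L[ℝ] ℝ :=
  (α ((extChartAt (𝓡 (2 * n + 1)) x₀).symm y)).comp
    (mfderiv (𝓡 (2 * n + 1)) (𝓡 (2 * n + 1)) (extChartAt (𝓡 (2 * n + 1)) x₀).symm y)

/-- The exterior derivative of the 1-form `α` at `x`, computed in the chart around `x` (the chart
through which `TangentSpace _ x` is identified with the model space):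
`dα (v, w) = D_v α (w) - D_w α (v)`. -/
def oneFormExtDeriv (α : ∀ x : N, TangentSpace (𝓡 (2 * n + 1)) x →L[ℝ] ℝ) (x : N)
    (v w : TangentSpace (𝓡 (2 * n + 1)) x) : ℝ :=
  let D : OddModel n →L[ℝ] OddModel n →L[ℝ] ℝ :=
    fderiv ℝ (oneFormInChart α x) (extChartAt (𝓡 (2 * n + 1)) x x)
  D v w - D w v

/-- `α` is a contact form on the `(2n+1)`-manifold `N`: a smooth nowhere vanishing 1-form such that
`dα` is nondegenerate on the hyperplane field `ξ = ker α`. -/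
structure IsContactForm [IsManifold (𝓡 (2 * n + 1)) ∞ N]
    (α : ∀ x : N, TangentSpace (𝓡 (2 * n + 1)) x →L[ℝ] ℝ) : Prop where
  /-- `α` is a smooth section of the cotangent bundle. -/
  smooth : ContMDiff (𝓡 (2 * n + 1)) ((𝓡 (2 * n + 1)).prod 𝓘(ℝ, OddModel n →L[ℝ] ℝ)) ∞
    (fun x : N ↦ Bundle.TotalSpace.mk' (OddModel n →L[ℝ] ℝ)
      (E := fun x : N ↦ TangentSpace (𝓡 (2 * n + 1)) x →L[ℝ] Bundle.Trivial N ℝ x) x (α x))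
  ne_zero : ∀ x : N, α x ≠ 0
  nondegenerate : ∀ (x : N) (v : TangentSpace (𝓡 (2 * n + 1)) x), α x v = 0 →
    (∀ w : TangentSpace (𝓡 (2 * n + 1)) x, α x w = 0 → oneFormExtDeriv α x v w = 0) → v = 0

/-- The Reeb vector field `R` of `α`, determined by `α(R) = 1` and `dα(R, ·) = 0` (for a contact
form there is exactly one such vector at every point). -/
def reebField (α : ∀ x : N, TangentSpace (𝓡 (2 * n + 1)) x →L[ℝ] ℝ) (x : N) :
    TangentSpace (𝓡 (2 * n + 1)) x :=
  Classical.epsilon fun v : TangentSpace (𝓡 (2 * n + 1)) x ↦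
    α x v = 1 ∧ ∀ w : TangentSpace (𝓡 (2 * n + 1)) x, oneFormExtDeriv α x v w = 0

/-- The diffeomorphism `Φ` is the time-`t` map of the Reeb flow: every `x` is carried to `Φ x` in
time `t` along an integral curve of the Reeb vector field. -/
def IsReebTimeMap (α : ∀ x : N, TangentSpace (𝓡 (2 * n + 1)) x →L[ℝ] ℝ) (t : ℝ)
    (Φ : N ≃ₘ⟮𝓡 (2 * n + 1), 𝓡 (2 * n + 1)⟯ N) : Prop :=
  ∀ x : N, ∃ γ : ℝ → N, IsMIntegralCurve (I := 𝓡 (2 * n + 1)) γ (reebField α) ∧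
    γ 0 = x ∧ γ t = Φ x

/-- The Reeb flow `t ↦ φ_R^t` as a family of diffeomorphisms (on a closed manifold there is exactly
one diffeomorphism that is the time-`t` map of the flow of the Reeb vector field). -/
def reebFlow (α : ∀ x : N, TangentSpace (𝓡 (2 * n + 1)) x →L[ℝ] ℝ) (t : ℝ) :
    N ≃ₘ⟮𝓡 (2 * n + 1), 𝓡 (2 * n + 1)⟯ N :=
  @Classical.epsilon _ ⟨Diffeomorph.refl (𝓡 (2 * n + 1)) N ∞⟩ (IsReebTimeMap α t)

/-- The Reeb one-parameter subgroup `{φ_R^t | t ∈ ℝ}`. -/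
def reebSubgroup (α : ∀ x : N, TangentSpace (𝓡 (2 * n + 1)) x →L[ℝ] ℝ) :
    Set (N ≃ₘ⟮𝓡 (2 * n + 1), 𝓡 (2 * n + 1)⟯ N) :=
  Set.range (reebFlow α)

/-- `ψ` is a contactomorphism of `(N, ker α)`: its differential maps `ξ = ker α` to itself
and preserves the co-orientation of `ξ` given by `α`. -/
def IsContactomorphism (α : ∀ x : N, TangentSpace (𝓡 (2 * n + 1)) x →L[ℝ] ℝ)
    (ψ : N ≃ₘ⟮𝓡 (2 * n + 1), 𝓡 (2 * n + 1)⟯ N) : Prop :=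
  ∀ (x : N) (v : TangentSpace (𝓡 (2 * n + 1)) x),
    (α (ψ x) (mfderiv (𝓡 (2 * n + 1)) (𝓡 (2 * n + 1)) ψ x v) = 0 ↔ α x v = 0) ∧
    (0 < α (ψ x) (mfderiv (𝓡 (2 * n + 1)) (𝓡 (2 * n + 1)) ψ x v) ↔ 0 < α x v)

/-- `{Ψ t}`, `t ∈ [0,1]`, is a contact isotopy: a smooth path of contactomorphisms that starts at
the identity. Only the values for `t ∈ [0,1]` matter. -/
structure IsContactIsotopy (α : ∀ x : N, TangentSpace (𝓡 (2 * n + 1)) x →L[ℝ] ℝ)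
    (Ψ : ℝ → N ≃ₘ⟮𝓡 (2 * n + 1), 𝓡 (2 * n + 1)⟯ N) : Prop where
  smooth : ContMDiffOn (𝓘(ℝ, ℝ).prod (𝓡 (2 * n + 1))) (𝓡 (2 * n + 1)) ∞
    (fun p : ℝ × N ↦ Ψ p.1 p.2) (Set.Icc 0 1 ×ˢ Set.univ)
  contact : ∀ t ∈ Set.Icc (0 : ℝ) 1, IsContactomorphism α (Ψ t)
  zero : Ψ 0 = Diffeomorph.refl (𝓡 (2 * n + 1)) N ∞

/-- `Cont₀(N, ker α)`: the contactomorphisms isotopic to the identity through contactomorphisms. -/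
def Cont₀ (α : ∀ x : N, TangentSpace (𝓡 (2 * n + 1)) x →L[ℝ] ℝ) :
    Set (N ≃ₘ⟮𝓡 (2 * n + 1), 𝓡 (2 * n + 1)⟯ N) :=
  {ψ | ∃ Ψ : ℝ → N ≃ₘ⟮𝓡 (2 * n + 1), 𝓡 (2 * n + 1)⟯ N, IsContactIsotopy α Ψ ∧ Ψ 1 = ψ}

/-- The velocity `d/ds Ψ s x` at `s = t ∈ [0,1]` (one-sided at the end points), a tangent vector
at `Ψ t x`. -/
def isotopyVelocity (Ψ : ℝ → N ≃ₘ⟮𝓡 (2 * n + 1), 𝓡 (2 * n + 1)⟯ N) (t : ℝ) (x : N) :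
    TangentSpace (𝓡 (2 * n + 1)) (Ψ t x) :=
  mfderivWithin 𝓘(ℝ, ℝ) (𝓡 (2 * n + 1)) (fun s : ℝ ↦ Ψ s x) (Set.Icc 0 1) t (1 : ℝ)

/-- The contact Hamiltonian `H t y = α(Y_t)(y)` of the isotopy `Ψ`, where
`Y_t = (d/dt Ψ_t) ∘ Ψ_t⁻¹` is the time-dependent vector field that generates `Ψ`. -/
def contactHamiltonian (α : ∀ x : N, TangentSpace (𝓡 (2 * n + 1)) x →L[ℝ] ℝ)
    (Ψ : ℝ → N ≃ₘ⟮𝓡 (2 * n + 1), 𝓡 (2 * n + 1)⟯ N) (t : ℝ) (y : N) : ℝ :=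
  α (Ψ t ((Ψ t).symm y)) (isotopyVelocity Ψ t ((Ψ t).symm y))

/-- The Hofer energy `|ψ|_α`, the infimum over all contact isotopies from the identity to `ψ` of
`∫₀¹ max_N |H_t| dt`. -/
def hoferEnergy (α : ∀ x : N, TangentSpace (𝓡 (2 * n + 1)) x →L[ℝ] ℝ)
    (ψ : N ≃ₘ⟮𝓡 (2 * n + 1), 𝓡 (2 * n + 1)⟯ N) : ℝ :=
  sInf {e : ℝ | ∃ Ψ : ℝ → N ≃ₘ⟮𝓡 (2 * n + 1), 𝓡 (2 * n + 1)⟯ N,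
    IsContactIsotopy α Ψ ∧ Ψ 1 = ψ ∧
    e = ∫ t in (0 : ℝ)..1, ⨆ y : N, |contactHamiltonian α Ψ t y|}

/-- The oscillation Hofer energy `|ψ|^osc_α`, the infimum over all contact isotopies from the
identity to `ψ` of `∫₀¹ (max_N H_t - min_N H_t) dt`. -/
def oscHoferEnergy (α : ∀ x : N, TangentSpace (𝓡 (2 * n + 1)) x →L[ℝ] ℝ)
    (ψ : N ≃ₘ⟮𝓡 (2 * n + 1), 𝓡 (2 * n + 1)⟯ N) : ℝ :=
  sInf {e : ℝ | ∃ Ψ : ℝ → N ≃ₘ⟮𝓡 (2 * n + 1), 𝓡 (2 * n + 1)⟯ N,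
    IsContactIsotopy α Ψ ∧ Ψ 1 = ψ ∧
    e = ∫ t in (0 : ℝ)..1,
      ((⨆ y : N, contactHamiltonian α Ψ t y) - ⨅ y : N, contactHamiltonian α Ψ t y)}

/-- The contact Hofer distance `d_α(φ, ψ) = |ψ ∘ φ⁻¹|_α`. -/
def contactHoferDist (α : ∀ x : N, TangentSpace (𝓡 (2 * n + 1)) x →L[ℝ] ℝ)
    (φ ψ : N ≃ₘ⟮𝓡 (2 * n + 1), 𝓡 (2 * n + 1)⟯ N) : ℝ :=
  hoferEnergy α (φ.symm.trans ψ)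

/-- The distance `d_α(ψ, S)` from `ψ` to a set `S`. -/
def contactHoferDistToSet (α : ∀ x : N, TangentSpace (𝓡 (2 * n + 1)) x →L[ℝ] ℝ)
    (ψ : N ≃ₘ⟮𝓡 (2 * n + 1), 𝓡 (2 * n + 1)⟯ N)
    (S : Set (N ≃ₘ⟮𝓡 (2 * n + 1), 𝓡 (2 * n + 1)⟯ N)) : ℝ :=
  sInf (contactHoferDist α ψ '' S)

end

/-! The Reeb flow preserves `α` and has constant Hamiltonian, so composing an isotopy with a
reparametrized Reeb flow `φ_R^{b(t)}` shifts its Hamiltonian by the constant `b'(t)` at each time.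
Such a shift does not affect the oscillation, and choosing it well lowers `max |H_t|` to half of the
oscillation.

Both inequalities use paths `t ↦ φ_R^{b(t)} ∘ Θ_{1-t} ∘ χ`, whose Hamiltonian, pulled back along the
path, is `b'(t)` minus that of `Θ` at time `1 - t` (`isotopyPairing_reeb_comp_reverse`). Reversing
time replaces inverting `Θ_t`, so smoothness of the inverse isotopy is never needed. If `Θ` runs
from `1` to `ψ`, then `χ = ψ⁻¹` and `b' ≈ (max + min) / 2` give a path to some `φ_R^s ψ⁻¹` of energy
at most half the oscillation energy plus `ε`. If `Θ` runs from `1` to `φ_R^s ψ⁻¹`, then `χ = ψ` and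
`b(t) = st - s` give a path to `ψ` with oscillation at most `2 max |H_{1-t}|`, where `H` is the
Hamiltonian of `Θ`.

Most of the work is to show that the Reeb flow exists, is smooth in time and space and preserves
`α`. The Reeb field solves `ι_v dα + α(v) α = α`, a linear equation with invertible coefficients,
hence is smooth (`contMDiff_reebField`). Smooth dependence of integral curves on time and initial
point comes from the implicit function theorem in a space of curves, and compactness makes the flow
global (`exists_contMDiff_flow`). Invariance of `α` is Cartan's formula `L_R α = ι_R dα + d(α(R)) =
0`, computed in charts (`pairing_mfderiv_reeb_flow`). -/

open scoped Topology

universe u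

/-! ### Superposition operators on spaces of continuous maps. -/

section Nemytskii

variable {K : Type*} [TopologicalSpace K] [CompactSpace K]

/-- Pointwise application of a continuous family of operators to a continuous family of vectors. -/
noncomputable def ContinuousMap.pointwiseApplyL (K : Type*) [TopologicalSpace K] [CompactSpace K]
    (E F : Type*) [NormedAddCommGroup E] [NormedSpace ℝ E] [NormedAddCommGroup F]
    [NormedSpace ℝ F] : C(K, E →L[ℝ] F) →L[ℝ] C(K, E) →L[ℝ] C(K, F) :=
  LinearMap.mkContinuous₂
    (LinearMap.mk₂ ℝ (fun (A : C(K, E →L[ℝ] F)) (h : C(K, E)) ↦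
        (⟨fun k ↦ A k (h k), by fun_prop⟩ : C(K, F)))
      (fun _ _ _ ↦ by ext; simp) (fun _ _ _ ↦ by ext; simp)
      (fun _ _ _ ↦ by ext; simp) (fun _ _ _ ↦ by ext; simp))
    1 (fun A h ↦ by
      rw [ContinuousMap.norm_le _ (by positivity)]
      intro k
      rw [one_mul]
      exact ((A k).le_opNorm (h k)).trans
        (mul_le_mul (A.norm_coe_le_norm k) (h.norm_coe_le_norm k) (norm_nonneg _) (by positivity)))

/-- Since `K` is compact, post-composition with `w` is continuous for the sup norm, which gives the
uniformity in `k` although `w` need not be uniformly continuous on `E`. -/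
lemma ContinuousMap.exists_dist_comp_left_lt {E G : Type*} [NormedAddCommGroup E]
    [NormedAddCommGroup G] (w : C(E, G)) (γ : C(K, E)) {c : ℝ} (hc : 0 < c) :
    ∃ δ > 0, ∀ η : C(K, E), dist η γ < δ → ∀ k, ‖w (η k) - w (γ k)‖ < c := by
  obtain ⟨δ, hδ, h⟩ := (Metric.continuousAt_iff (α := C(K, E))
    (β := C(K, G))).mp (ContinuousMap.continuous_postcomp w).continuousAt c hc
  refine ⟨δ, hδ, fun η hη k ↦ ?_⟩
  rw [← dist_eq_norm]
  exact (ContinuousMap.dist_apply_le_dist (f := w.comp η) (g := w.comp γ) k).trans_lt (h hη)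

variable {E F : Type u} [NormedAddCommGroup E] [NormedSpace ℝ E] [NormedAddCommGroup F]
  [NormedSpace ℝ F]

/-- The superposition operator `γ ↦ v ∘ γ` of a `C¹` map `v` is differentiable. -/
theorem ContinuousMap.hasFDerivAt_comp_left (v : C(E, F)) (hv : ContDiff ℝ 1 v) (γ : C(K, E)) :
    HasFDerivAt (fun η : C(K, E) ↦ v.comp η)
      (ContinuousMap.pointwiseApplyL K E F
        ((⟨fderiv ℝ v, hv.continuous_fderiv one_ne_zero⟩ : C(E, E →L[ℝ] F)).comp γ)) γ := by
  rw [hasFDerivAt_iff_isLittleO_nhds_zero, Asymptotics.isLittleO_iff]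
  intro c hc
  set v' : C(E, E →L[ℝ] F) := ⟨fderiv ℝ v, hv.continuous_fderiv one_ne_zero⟩ with hv'
  obtain ⟨δ, hδ, hball⟩ := ContinuousMap.exists_dist_comp_left_lt v' γ hc
  filter_upwards [Metric.ball_mem_nhds (0 : C(K, E)) hδ] with h hh
  rw [mem_ball_zero_iff] at hh
  rw [ContinuousMap.norm_le _ (by positivity)]
  intro k
  have hseg : ∀ z ∈ segment ℝ (γ k) (γ k + h k), ‖fderiv ℝ v z - v' (γ k)‖ ≤ c := by
    intro z hz
    rw [segment_eq_image'] at hz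
    obtain ⟨θ, hθ, rfl⟩ := hz
    have hdist : dist (γ + θ • h) γ < δ := by
      rw [dist_eq_norm, add_sub_cancel_left, norm_smul, Real.norm_of_nonneg hθ.1]
      exact (mul_le_of_le_one_left (norm_nonneg _) hθ.2).trans_lt hh
    simpa [hv'] using (hball _ hdist k).le
  have := (convex_segment (γ k) (γ k + h k)).norm_image_sub_le_of_norm_hasFDerivWithin_le'
    (fun z _ ↦ (hv.differentiable one_ne_zero z).hasFDerivAt.hasFDerivWithinAt) hseg
    (left_mem_segment ℝ _ _) (right_mem_segment ℝ _ _)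
  rw [add_sub_cancel_left] at this
  exact this.trans (mul_le_mul_of_nonneg_left (h.norm_coe_le_norm k) hc.le)

/-- The superposition operator `γ ↦ v ∘ γ` of a `Cᵐ` map `v` is `Cᵐ`. -/
theorem ContinuousMap.contDiff_comp_left (m : ℕ) :
    ∀ {F : Type u} [NormedAddCommGroup F] [NormedSpace ℝ F] (v : C(E, F)), ContDiff ℝ m v →
      ContDiff ℝ m (fun η : C(K, E) ↦ v.comp η) := by
  induction m with
  | zero =>
    intro F _ _ v _
    exact contDiff_zero.mpr (ContinuousMap.continuous_postcomp v)
  | succ m ih =>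
    intro F _ _ v hv
    have hv1 : ContDiff ℝ 1 v := hv.of_le (by norm_cast; omega)
    rw [Nat.cast_succ, contDiff_succ_iff_hasFDerivAt]
    -- The derivative is a bounded linear operator applied to the superposition operator of `fderiv
    -- ℝ v`. The induction hypothesis is used with target `E →L[ℝ] F`, which is why `F` varies in
    -- the induction.
    refine ⟨_, ?_, fun γ ↦ ContinuousMap.hasFDerivAt_comp_left v hv1 γ⟩
    refine (ContinuousMap.pointwiseApplyL K E F).contDiff.comp (ih _ ?_)
    exact hv.fderiv_right (by norm_cast)

end Nemytskii

/-! ### Smooth dependence of integral curves in a Banach space. -/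

section LocalFlow

variable {E : Type u} [NormedAddCommGroup E] [NormedSpace ℝ E]

/-- Integration from `0` as a continuous linear operator on `C([-2,2], E)`. -/
noncomputable def ContinuousMap.primitiveL (E : Type*) [NormedAddCommGroup E] [NormedSpace ℝ E] :
    C(Set.Icc (-2 : ℝ) 2, E) →L[ℝ] C(Set.Icc (-2 : ℝ) 2, E) :=
  LinearMap.mkContinuous
    { toFun := fun γ ↦ ⟨fun τ ↦ ∫ σ in (0 : ℝ)..τ, Set.IccExtend (by norm_num) γ σ, by
        have : Continuous fun t : ℝ ↦ ∫ σ in (0 : ℝ)..t, Set.IccExtend (by norm_num) γ σ :=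
          intervalIntegral.continuous_primitive
            (fun _ _ ↦ (γ.continuous.Icc_extend' (h := by norm_num)).intervalIntegrable _ _) 0
        exact this.comp continuous_subtype_val⟩
      map_add' := fun γ η ↦ by
        ext τ
        exact intervalIntegral.integral_add
          ((γ.continuous.Icc_extend' (h := by norm_num)).intervalIntegrable _ _)
          ((η.continuous.Icc_extend' (h := by norm_num)).intervalIntegrable _ _)
      map_smul' := fun r γ ↦ by
        ext τ
        exact intervalIntegral.integral_smul r _ }
    2 (fun γ ↦ by
      rw [ContinuousMap.norm_le _ (by positivity)]
      intro τ
      refine (intervalIntegral.norm_integral_le_of_norm_le_const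
        (C := ‖γ‖) fun σ _ ↦ γ.norm_coe_le_norm _).trans ?_
      rw [mul_comm]
      refine mul_le_mul_of_nonneg_right ?_ (norm_nonneg _)
      rw [sub_zero, abs_le]
      exact τ.2)

lemma ContinuousMap.primitiveL_apply (γ : C(Set.Icc (-2 : ℝ) 2, E)) (τ : Set.Icc (-2 : ℝ) 2) :
    ContinuousMap.primitiveL E γ τ = ∫ σ in (0 : ℝ)..τ, Set.IccExtend (by norm_num) γ σ := rfl

/-- Solutions of `γ' = s • v γ`, `γ 0 = x` on `[-2,2]` depend in a `Cᵐ` way on `(s, x)`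
near `(0, x₀)`. -/
theorem exists_contDiffAt_scaled_integralCurve [CompleteSpace E] {m : ℕ} (hm : m ≠ 0)
    (v : C(E, E)) (hv : ContDiff ℝ m v) (x₀ : E) :
    ∃ g : ℝ × E → C(Set.Icc (-2 : ℝ) 2, E), ContDiffAt ℝ m g (0, x₀) ∧
      g (0, x₀) = ContinuousMap.const _ x₀ ∧
      ∀ᶠ p in 𝓝 ((0 : ℝ), x₀),
        g p = ContinuousMap.const _ p.2 + p.1 • ContinuousMap.primitiveL E (v.comp (g p)) := by
  let C := C(Set.Icc (-2 : ℝ) 2, E)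
  let c : E →L[ℝ] C := ContinuousLinearMap.const ℝ (Set.Icc (-2 : ℝ) 2)
  -- The zeros of `f` are the solutions of the Picard integral equation. At `s = 0` the integral
  -- term drops out, so the partial derivative in the curve variable is the identity and the
  -- implicit function theorem applies. Time is rescaled by `s`, so all curves live on one fixed
  -- interval.
  let f : (ℝ × E) × C → C := fun q ↦
    q.2 - c q.1.2 - q.1.1 • ContinuousMap.primitiveL E (v.comp q.2)
  let u : (ℝ × E) × C := ((0, x₀), c x₀)
  have hN : ContDiff ℝ m fun η : C ↦ ContinuousMap.primitiveL E (v.comp η) :=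
    (ContinuousMap.primitiveL E).contDiff.comp (ContinuousMap.contDiff_comp_left m v hv)
  have hf : ContDiff ℝ m f :=
    (contDiff_snd.sub (c.contDiff.comp (contDiff_snd.comp contDiff_fst))).sub
      ((contDiff_fst.comp contDiff_fst).smul (hN.comp contDiff_snd))
  have hm' : (m : WithTop ℕ∞) ≠ 0 := by exact_mod_cast hm
  have hfu : f u = 0 := by simp [f, u]
  have hpart : fderiv ℝ f u ∘L .inr ℝ (ℝ × E) C = ContinuousLinearMap.id ℝ C := by
    have h1 : HasFDerivAt (fun η : C ↦ f ((0, x₀), η))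
        (fderiv ℝ f u ∘L .inr ℝ (ℝ × E) C) (c x₀) :=
      (hf.differentiable hm' u).hasFDerivAt.comp (c x₀) (hasFDerivAt_prodMk_right (0, x₀) (c x₀))
    have h2 : HasFDerivAt (fun η : C ↦ f ((0, x₀), η)) (ContinuousLinearMap.id ℝ C) (c x₀) := by
      have : (fun η : C ↦ f ((0, x₀), η)) = fun η ↦ η - c x₀ := by
        funext η; simp [f]
      rw [this]
      exact (hasFDerivAt_id _).sub_const _
    exact h1.unique h2
  have hinv : (fderiv ℝ f u ∘L .inr ℝ (ℝ × E) C).IsInvertible := by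
    rw [hpart]; exact ⟨ContinuousLinearEquiv.refl ℝ C, rfl⟩
  have hfu' : ContDiffAt ℝ m f u := hf.contDiffAt
  refine ⟨hfu'.implicitFunction hm' hinv, hfu'.contDiffAt_implicitFunction hm' hinv, ?_, ?_⟩
  · exact hfu'.implicitFunction_apply_self hm' hinv
  · filter_upwards [hfu'.eventually_apply_implicitFunction hm' hinv] with p hp
    rw [hfu] at hp
    change _ - c p.2 - p.1 • ContinuousMap.primitiveL E (v.comp _) = 0 at hp
    rw [sub_sub, sub_eq_zero] at hp
    exact hp

lemma hasDerivAt_IccExtend_of_eq_primitiveL [CompleteSpace E] {v : C(E, E)} {x : E} {s : ℝ}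
    {γ : C(Set.Icc (-2 : ℝ) 2, E)}
    (h : γ = ContinuousMap.const _ x + s • ContinuousMap.primitiveL E (v.comp γ)) {τ : ℝ}
    (hτ : τ ∈ Set.Ioo (-2 : ℝ) 2) :
    HasDerivAt (Set.IccExtend (by norm_num : (-2 : ℝ) ≤ 2) γ)
      (s • v (Set.IccExtend (by norm_num : (-2 : ℝ) ≤ 2) γ τ)) τ := by
  have hle : (-2 : ℝ) ≤ 2 := by norm_num
  have hcont : Continuous (Set.IccExtend hle (v.comp γ)) :=
    (v.comp γ).continuous.Icc_extend' (h := hle)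
  have hd : HasDerivAt (fun t : ℝ ↦ x + s • ∫ σ in (0 : ℝ)..t, Set.IccExtend hle (v.comp γ) σ)
      (s • v (Set.IccExtend hle γ τ)) τ :=
    ((intervalIntegral.integral_hasDerivAt_right (hcont.intervalIntegrable _ _)
      (hcont.stronglyMeasurableAtFilter _ _) hcont.continuousAt).const_smul s).const_add x
  refine hd.congr_of_eventuallyEq ?_
  filter_upwards [isOpen_Ioo.mem_nhds hτ] with t ht
  rw [Set.IccExtend_of_mem hle _ (Set.Ioo_subset_Icc_self ht)]
  conv_lhs => rw [h]
  rfl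

lemma IccExtend_zero_of_eq_primitiveL {v : C(E, E)} {x : E} {s : ℝ}
    {γ : C(Set.Icc (-2 : ℝ) 2, E)}
    (h : γ = ContinuousMap.const _ x + s • ContinuousMap.primitiveL E (v.comp γ)) :
    Set.IccExtend (by norm_num : (-2 : ℝ) ≤ 2) γ 0 = x := by
  rw [Set.IccExtend_of_mem _ _ (by norm_num : (0 : ℝ) ∈ Set.Icc (-2 : ℝ) 2), h]
  simp [ContinuousMap.primitiveL_apply]

end LocalFlow

/-! ### Flows of vector fields on compact manifolds. -/

section ManifoldFlow

open Set

universe w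

variable {E : Type w} [NormedAddCommGroup E] [NormedSpace ℝ E] [FiniteDimensional ℝ E]
  {M : Type*} [TopologicalSpace M] [ChartedSpace E M]

omit [FiniteDimensional ℝ E] in
/-- Smoothness of a vector field at `x₀` can be read in the chart around `x₀`. -/
lemma contMDiffAt_vectorField_iff [IsManifold 𝓘(ℝ, E) ∞ M] {m : WithTop ℕ∞}
    {v : ∀ x : M, TangentSpace 𝓘(ℝ, E) x} {x₀ : M} :
    ContMDiffAt 𝓘(ℝ, E) 𝓘(ℝ, E).tangent m (fun x ↦ (⟨x, v x⟩ : TangentBundle 𝓘(ℝ, E) M)) x₀ ↔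
      ContMDiffAt 𝓘(ℝ, E) 𝓘(ℝ, E) m
        (fun x ↦ (mfderiv 𝓘(ℝ, E) 𝓘(ℝ, E) (extChartAt 𝓘(ℝ, E) x₀) x (v x) : E)) x₀ := by
  have : IsManifold 𝓘(ℝ, E) 1 M := .of_le (n := ∞) (by norm_cast)
  rw [Bundle.contMDiffAt_section]
  apply Filter.EventuallyEq.contMDiffAt_iff
  filter_upwards [(chartAt E x₀).open_source.mem_nhds (mem_chart_source E x₀)] with x hx
  have h1 := DFunLike.congr_fun
    (TangentBundle.continuousLinearMapAt_trivializationAt (𝕜 := ℝ) (I := 𝓘(ℝ, E)) hx) (v x)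
  have h2 : (trivializationAt E (TangentSpace 𝓘(ℝ, E) (M := M)) x₀).continuousLinearMapAt ℝ x (v x)
      = (trivializationAt E (TangentSpace 𝓘(ℝ, E)) x₀ ⟨x, v x⟩).2 := by
    rw [Bundle.Trivialization.continuousLinearMapAt_apply,
      Bundle.Trivialization.coe_linearMapAt_of_mem]
    simpa using hx
  exact h2.symm.trans h1

omit [FiniteDimensional ℝ E] in
lemma mfderiv_extChartAt_symm_apply_mfderiv [IsManifold 𝓘(ℝ, E) ∞ M] {x₀ : M} {y : E}
    (hy : y ∈ (extChartAt 𝓘(ℝ, E) x₀).target)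
    (v : TangentSpace 𝓘(ℝ, E) ((extChartAt 𝓘(ℝ, E) x₀).symm y)) :
    mfderiv 𝓘(ℝ, E) 𝓘(ℝ, E) (extChartAt 𝓘(ℝ, E) x₀).symm y
      (mfderiv 𝓘(ℝ, E) 𝓘(ℝ, E) (extChartAt 𝓘(ℝ, E) x₀) ((extChartAt 𝓘(ℝ, E) x₀).symm y) v) =
        v := by
  have : IsManifold 𝓘(ℝ, E) 1 M := .of_le (n := ∞) (by norm_cast)
  have := mfderivWithin_extChartAt_symm_comp_mfderiv_extChartAt hy
  simp only [modelWithCornersSelf_coe, range_id, mfderivWithin_univ] at this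
  exact DFunLike.congr_fun this v

/-- Local flow of a vector field, with time rescaled to `(-2, 2)`. -/
theorem exists_contMDiffAt_scaled_integralCurve [IsManifold 𝓘(ℝ, E) ∞ M]
    {v : ∀ x : M, TangentSpace 𝓘(ℝ, E) x} {m : ℕ} (hm : m ≠ 0) {x₀ : M}
    (hv : ContMDiffAt 𝓘(ℝ, E) 𝓘(ℝ, E).tangent m
      (fun x ↦ (⟨x, v x⟩ : TangentBundle 𝓘(ℝ, E) M)) x₀) :
    ∃ c : ℝ → M → ℝ → M,
      ContMDiffAt (𝓘(ℝ, ℝ).prod 𝓘(ℝ, E)) 𝓘(ℝ, E) m (fun p : ℝ × M ↦ c p.1 p.2 1) (0, x₀) ∧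
      ∀ᶠ p in 𝓝 ((0 : ℝ), x₀), c p.1 p.2 0 = p.2 ∧
        IsMIntegralCurveOn (c p.1 p.2) (p.1 • v) (Ioo (-2) 2) := by
  have hI1 : IsManifold 𝓘(ℝ, E) 1 M := .of_le (n := ∞) (by norm_cast)
  have hIm : IsManifold 𝓘(ℝ, E) m M := .of_le (n := ∞) (by norm_cast; exact le_top)
  let e := extChartAt 𝓘(ℝ, E) x₀
  let y₀ : E := e x₀
  let w : E → E := fun y ↦ mfderiv 𝓘(ℝ, E) 𝓘(ℝ, E) e (e.symm y) (v (e.symm y))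
  have hsymm : e.symm y₀ = x₀ := extChartAt_to_inv x₀
  have hesymm : ContMDiffAt 𝓘(ℝ, E) 𝓘(ℝ, E) m e.symm y₀ :=
    (contMDiffOn_extChartAt_symm x₀).contMDiffAt (extChartAt_target_mem_nhds x₀)
  have hw : ContDiffAt ℝ m w y₀ := by
    rw [← contMDiffAt_iff_contDiffAt]
    exact (contMDiffAt_vectorField_iff.mp hv).comp_of_eq hesymm hsymm
  obtain ⟨U, hU, hwU⟩ := hw.contDiffOn le_rfl (by simp)
  obtain ⟨r, hr, hrU⟩ := Metric.nhds_basis_closedBall.mem_iff.mp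
    (Filter.inter_mem (interior_mem_nhds.mpr hU) (extChartAt_target_mem_nhds (I := 𝓘(ℝ, E)) x₀))
  -- Cutting off makes the field globally `Cᵐ` on `E` without changing it on the ball of radius `r /
  -- 2`, where the curves will be shown to stay.
  let χ : ContDiffBump y₀ := ⟨r / 2, r, half_pos hr, half_lt_self hr⟩
  have hχw : ContDiff ℝ m fun y ↦ χ y • w y := by
    rw [contDiff_iff_contDiffAt]
    intro y
    by_cases hy : y ∈ Metric.closedBall y₀ r
    · exact χ.contDiff.contDiffAt.smul
        (hwU.contDiffAt (mem_interior_iff_mem_nhds.mp (hrU hy).1))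
    · refine (contDiffAt_const (c := (0 : E))).congr_of_eventuallyEq ?_
      filter_upwards [Metric.isClosed_closedBall.isOpen_compl.mem_nhds hy] with z hz
      rw [χ.zero_of_le_dist, zero_smul]
      exact le_of_not_ge fun h ↦ hz h
  have hχ : ∀ y ∈ Metric.ball y₀ (r / 2), χ y • w y = w y := fun y hy ↦ by
    rw [χ.one_of_mem_closedBall (Metric.ball_subset_closedBall hy), one_smul]
  let V : C(E, E) := ⟨fun y ↦ χ y • w y, hχw.continuous⟩
  obtain ⟨g, hg, hg0, hgev⟩ := exists_contDiffAt_scaled_integralCurve hm V hχw y₀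
  have hle : (-2 : ℝ) ≤ 2 := by norm_num
  refine ⟨fun s x τ ↦ e.symm (IccExtend hle (g (s, e x)) τ), ?_, ?_⟩
  · let ev : C(Icc (-2 : ℝ) 2, E) →L[ℝ] E := ContinuousMap.evalCLM ℝ ⟨1, by norm_num⟩
    have h1 : ContMDiffAt (𝓘(ℝ, ℝ).prod 𝓘(ℝ, E)) 𝓘(ℝ, ℝ × E) m
        (fun p : ℝ × M ↦ (p.1, e p.2)) (0, x₀) :=
      contMDiffAt_fst.prodMk_space ((contMDiffAt_extChartAt (x := x₀)).comp (0, x₀) contMDiffAt_snd)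
    have h2 : ContDiffAt ℝ m (fun q : ℝ × E ↦ g q ⟨1, by norm_num⟩) (0, y₀) :=
      ev.contDiff.contDiffAt.comp (0, y₀) hg
    have h3 : ContMDiffAt (𝓘(ℝ, ℝ).prod 𝓘(ℝ, E)) 𝓘(ℝ, E) m
        (fun p : ℝ × M ↦ g (p.1, e p.2) ⟨1, by norm_num⟩) (0, x₀) :=
      h2.contMDiffAt.comp (0, x₀) h1
    have h4 := hesymm.comp_of_eq h3 (by
      change g (0, y₀) _ = y₀
      rw [hg0, ContinuousMap.const_apply])
    refine h4.congr_of_eventuallyEq (.of_forall fun p ↦ ?_)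
    simp only [Function.comp_apply]
    rw [IccExtend_of_mem hle _ (by norm_num : (1 : ℝ) ∈ Icc (-2 : ℝ) 2)]
  · have hcont : ContinuousAt (fun p : ℝ × M ↦ (p.1, e p.2)) (0, x₀) :=
      continuousAt_fst.prodMk ((continuousAt_extChartAt (I := 𝓘(ℝ, E)) x₀).comp_of_eq
        continuousAt_snd rfl)
    have hev1 := hcont.eventually hgev
    -- Closeness in sup norm to the constant curve `y₀` keeps the whole curve in the region where
    -- the cut-off field equals the original one.
    have hev2 : ∀ᶠ q in 𝓝 ((0 : ℝ), y₀), dist (g q) (g (0, y₀)) < r / 2 :=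
      hg.continuousAt.eventually (Metric.ball_mem_nhds _ (half_pos hr))
    have hev3 : ∀ᶠ p in 𝓝 ((0 : ℝ), x₀), p.2 ∈ e.source :=
      continuousAt_snd.eventually (extChartAt_source_mem_nhds x₀)
    filter_upwards [hev1, hcont.eventually hev2, hev3] with p hp1 hp2 hp3
    have hball : ∀ τ, IccExtend hle (g (p.1, e p.2)) τ ∈ Metric.ball y₀ (r / 2) := fun τ ↦ by
      have := (ContinuousMap.dist_apply_le_dist (projIcc _ _ hle τ)).trans_lt hp2
      rwa [hg0] at this
    refine ⟨?_, fun τ hτ ↦ ?_⟩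
    · rw [IccExtend_zero_of_eq_primitiveL hp1]
      exact e.left_inv hp3
    · have hd := hasDerivAt_IccExtend_of_eq_primitiveL hp1 hτ
      set z := IccExtend hle (g (p.1, e p.2)) τ with hz
      have hztarget : z ∈ e.target :=
        (hrU (Metric.ball_subset_closedBall (Metric.ball_subset_ball (by linarith) (hball τ)))).2
      have hVz : V z = w z := hχ z (hball τ)
      rw [hVz] at hd
      have hs : HasMFDerivAt 𝓘(ℝ, E) 𝓘(ℝ, E) e.symm z
          (mfderiv 𝓘(ℝ, E) 𝓘(ℝ, E) e.symm z) :=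
        (((contMDiffOn_extChartAt_symm (n := m) x₀).contMDiffAt
          ((isOpen_extChartAt_target x₀).mem_nhds hztarget)).mdifferentiableAt
            (by exact_mod_cast hm)).hasMFDerivAt
      have hc := (hs.comp τ hd.hasFDerivAt.hasMFDerivAt).hasMFDerivWithinAt (s := Ioo (-2) 2)
      refine hc.congr_mfderiv (ContinuousLinearMap.ext fun (a : ℝ) ↦ ?_)
      have h5 : mfderiv 𝓘(ℝ, E) 𝓘(ℝ, E) e.symm z (w z) = v (e.symm z) :=
        mfderiv_extChartAt_symm_apply_mfderiv hztarget _
      change mfderiv 𝓘(ℝ, E) 𝓘(ℝ, E) e.symm z (a • (p.1 • w z)) = a • (p.1 • v (e.symm z))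
      rw [← h5]
      exact (map_smul _ _ _).trans (congrArg _ (map_smul _ _ _))

/-- A smooth vector field on a compact manifold has a globally defined smooth flow. -/
theorem exists_contMDiff_flow [IsManifold 𝓘(ℝ, E) ∞ M] [T2Space M] [CompactSpace M]
    {v : ∀ x : M, TangentSpace 𝓘(ℝ, E) x}
    (hv : ContMDiff 𝓘(ℝ, E) 𝓘(ℝ, E).tangent ∞
      (fun x ↦ (⟨x, v x⟩ : TangentBundle 𝓘(ℝ, E) M))) :
    ∃ φ : ℝ → M → M, ContMDiff (𝓘(ℝ, ℝ).prod 𝓘(ℝ, E)) 𝓘(ℝ, E) ∞ (fun p : ℝ × M ↦ φ p.1 p.2) ∧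
      (∀ x, φ 0 x = x) ∧ (∀ s t x, φ (s + t) x = φ s (φ t x)) ∧
      ∀ x, IsMIntegralCurve (fun t ↦ φ t x) v := by
  have hI1 : IsManifold 𝓘(ℝ, E) 1 M := .of_le (n := ∞) (by norm_cast)
  have hvm : ∀ m : ℕ, ContMDiff 𝓘(ℝ, E) 𝓘(ℝ, E).tangent m
      (fun x ↦ (⟨x, v x⟩ : TangentBundle 𝓘(ℝ, E) M)) := fun m ↦
    hv.of_le (by exact_mod_cast le_top)
  have hv1 : ContMDiff 𝓘(ℝ, E) 𝓘(ℝ, E).tangent 1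
      (fun x ↦ (⟨x, v x⟩ : TangentBundle 𝓘(ℝ, E) M)) := by exact_mod_cast hvm 1
  -- Compactness turns the local existence times into a uniform one, which suffices for global
  -- integral curves.
  have hunif : ∀ᶠ s in 𝓝 (0 : ℝ), ∀ x ∈ (univ : Set M), 0 < s →
      ∃ γ : ℝ → M, γ 0 = x ∧ IsMIntegralCurveOn γ v (Ioo (-s) s) := by
    refine isCompact_univ.eventually_forall_of_forall_eventually fun x₀ _ ↦ ?_
    obtain ⟨c, -, hc⟩ := exists_contMDiffAt_scaled_integralCurve one_ne_zero (hvm 1 x₀)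
    filter_upwards [hc] with p hp hs
    refine ⟨c p.1 p.2 ∘ (· * p.1⁻¹), by simp [hp.1], ?_⟩
    have := hp.2.comp_mul p.1⁻¹
    rw [smul_smul, inv_mul_cancel₀ hs.ne', one_smul] at this
    refine this.mono fun t ht ↦ ?_
    rw [mem_ofPred_eq, ← div_eq_mul_inv, mem_Ioo, lt_div_iff₀ hs, div_lt_iff₀ hs]
    constructor <;> linarith [ht.1, ht.2]
  obtain ⟨ε, hε, hpos⟩ := ((hunif.filter_mono nhdsWithin_le_nhds).and
    (self_mem_nhdsWithin (s := Ioi (0 : ℝ)))).exists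
  have hglob := exists_isMIntegralCurve_of_isMIntegralCurveOn hv1 hpos
    fun x ↦ hε x (mem_univ x) hpos
  choose φ hφ0 hφ using hglob
  have hadd : ∀ s t x, φ x (s + t) = φ (φ x t) s := fun s t x ↦ by
    have := isMIntegralCurve_Ioo_eq_of_contMDiff_boundaryless (t₀ := 0) hv1
      ((hφ x).comp_add t) (hφ (φ x t)) (by simp [hφ0])
    exact congrFun this s
  -- Near time `0`, both `τ ↦ φ x (sτ)` and the local solution are integral curves of `s • v`. By
  -- uniqueness they agree at `τ = 1`, so `φ` inherits the regularity of the local solution.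
  have hat0 : ∀ (m : ℕ) (x₀ : M), ContMDiffAt (𝓘(ℝ, ℝ).prod 𝓘(ℝ, E)) 𝓘(ℝ, E) (m + 1 : ℕ)
      (fun p : ℝ × M ↦ φ p.2 p.1) (0, x₀) := fun m x₀ ↦ by
    obtain ⟨c, hcs, hc⟩ := exists_contMDiffAt_scaled_integralCurve m.succ_ne_zero (hvm (m + 1) x₀)
    refine hcs.congr_of_eventuallyEq ?_
    filter_upwards [hc] with p hp
    have hsv : ContMDiff 𝓘(ℝ, E) 𝓘(ℝ, E).tangent 1
        (fun x ↦ (⟨x, (p.1 • v) x⟩ : TangentBundle 𝓘(ℝ, E) M)) := hv1.const_smul_section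
    have := isMIntegralCurveOn_Ioo_eqOn_of_contMDiff_boundaryless (t₀ := 0)
      (by norm_num : (0 : ℝ) ∈ Ioo (-2 : ℝ) 2) hsv
      (((hφ p.2).comp_mul p.1).isMIntegralCurveOn _) hp.2 (by simp [hp.1, hφ0])
    simpa using this (by norm_num : (1 : ℝ) ∈ Ioo (-2 : ℝ) 2)
  -- A finite order of regularity spreads from a point to a neighbourhood, whose size may depend on
  -- `m`. Hence the order is fixed first, and the time-`t` map is written as an iterate of the
  -- time-`t / k` map with `k` large.
  have hsmooth : ∀ (m : ℕ) (t : ℝ), ContMDiff 𝓘(ℝ, E) 𝓘(ℝ, E) (m + 1 : ℕ) (fun x ↦ φ x t) := by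
    intro m
    have hev : ∀ᶠ s in 𝓝 (0 : ℝ), ∀ x ∈ (univ : Set M),
        ContMDiffAt (𝓘(ℝ, ℝ).prod 𝓘(ℝ, E)) 𝓘(ℝ, E) (m + 1 : ℕ)
          (fun p : ℝ × M ↦ φ p.2 p.1) (s, x) :=
      isCompact_univ.eventually_forall_of_forall_eventually fun x₀ _ ↦
        (contMDiffAt_iff_contMDiffAt_nhds (by simp)).mp (hat0 m x₀)
    have hev' : ∀ᶠ s in 𝓝 (0 : ℝ), ContMDiff 𝓘(ℝ, E) 𝓘(ℝ, E) (m + 1 : ℕ) (fun x ↦ φ x s) := by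
      filter_upwards [hev] with s hs x
      exact (hs x (mem_univ x)).comp x (contMDiffAt_const.prodMk contMDiffAt_id)
    intro t
    have hlim : Filter.Tendsto (fun k : ℕ ↦ t / k) Filter.atTop (𝓝 0) :=
      tendsto_const_div_atTop_nhds_zero_nat t
    obtain ⟨k, hk, hk0⟩ := ((hlim.eventually hev').and (Filter.eventually_gt_atTop 0)).exists
    have hiter : ∀ j : ℕ, ContMDiff 𝓘(ℝ, E) 𝓘(ℝ, E) (m + 1 : ℕ) (fun x ↦ φ x (j * (t / k))) := by
      intro j
      induction j with
      | zero => simpa [hφ0] using! contMDiff_id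
      | succ j ih =>
        have : (fun x ↦ φ x ((j + 1 : ℕ) * (t / k))) =
            (fun x ↦ φ x (t / k)) ∘ fun x ↦ φ x (j * (t / k)) := by
          funext x
          rw [Function.comp_apply, ← hadd]
          congr 1
          push_cast
          ring
        rw [this]
        exact hk.comp ih
    have hkt : (k : ℝ) * (t / k) = t := by field_simp
    simpa [hkt] using hiter k
  refine ⟨fun t x ↦ φ x t, ?_, hφ0, fun s t x ↦ hadd s t x, hφ⟩
  rw [contMDiff_infty]
  intro m
  refine ContMDiff.of_le (n := (m + 1 : ℕ)) ?_ (by exact_mod_cast m.le_succ)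
  rintro ⟨t₀, x₀⟩
  -- The group law moves joint regularity from time `0` to time `t₀`: flow for the fixed time `t₀`,
  -- then for the small time `t - t₀`.
  have h1 : ContMDiffAt (𝓘(ℝ, ℝ).prod 𝓘(ℝ, E)) (𝓘(ℝ, ℝ).prod 𝓘(ℝ, E)) (m + 1 : ℕ)
      (fun p : ℝ × M ↦ (p.1 - t₀, φ p.2 t₀)) (t₀, x₀) :=
    (contMDiffAt_fst.sub contMDiffAt_const).prodMk
      ((hsmooth m t₀ x₀).comp (t₀, x₀) contMDiffAt_snd)
  have h2 := (hat0 m (φ x₀ t₀)).comp_of_eq h1 (by simp)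
  refine h2.congr_of_eventuallyEq (.of_forall fun p ↦ ?_)
  simp only [Function.comp_apply]
  rw [← hadd, sub_add_cancel]

end ManifoldFlow

/-! ### One-forms and contact linear algebra in normed spaces. -/

section NormedSpaceForms

variable {E : Type*} [NormedAddCommGroup E] [NormedSpace ℝ E]

/-- The exterior derivative of a 1-form commutes with pullback. -/
lemma fderiv_pullback_antisymm {F : Type*} [NormedAddCommGroup F] [NormedSpace ℝ F]
    {a : F → F →L[ℝ] ℝ} {f : E → F} {p : E}
    (ha : DifferentiableAt ℝ a (f p)) (hf : ContDiffAt ℝ 2 f p) (v w : E) :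
    fderiv ℝ (fun y ↦ (a (f y)).comp (fderiv ℝ f y)) p v w -
      fderiv ℝ (fun y ↦ (a (f y)).comp (fderiv ℝ f y)) p w v =
    fderiv ℝ a (f p) (fderiv ℝ f p v) (fderiv ℝ f p w) -
      fderiv ℝ a (f p) (fderiv ℝ f p w) (fderiv ℝ f p v) := by
  have hf1 : DifferentiableAt ℝ f p := hf.differentiableAt two_ne_zero
  have hf2 : DifferentiableAt ℝ (fderiv ℝ f) p :=
    (hf.fderiv_right (m := 1) (by norm_num)).differentiableAt one_ne_zero
  have hd : HasFDerivAt (fun y ↦ (a (f y)).comp (fderiv ℝ f y)) _ p :=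
    (ha.hasFDerivAt.comp p hf1.hasFDerivAt).clm_comp hf2.hasFDerivAt
  -- The terms containing the second derivative of `f` are symmetric in `v` and `w`, so they cancel
  -- in the difference.
  have hsymm : IsSymmSndFDerivAt ℝ f p := hf.isSymmSndFDerivAt (by simp)
  rw [hd.fderiv]
  simp [hsymm v w]

/-- Infinitesimal form of the invariance of a 1-form under a flow whose velocity pairs to `1` with
the form: the derivative is the contraction of the exterior derivative. -/
lemma hasDerivAt_pairing_flow {a : E → E →L[ℝ] ℝ} {r : E → E} {f : ℝ × E → E} {p : E}
    (ha : DifferentiableAt ℝ a p) (hr : DifferentiableAt ℝ r p)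
    (hf : ContDiffAt ℝ 2 f (0, p)) (hf0 : ∀ᶠ y in 𝓝 p, f (0, y) = y)
    (hfr : ∀ᶠ y in 𝓝 p, fderiv ℝ f (0, y) (1, 0) = r y) (har : ∀ᶠ y in 𝓝 p, a y (r y) = 1)
    (w : E) :
    HasDerivAt (fun t : ℝ ↦ a (f (t, p)) (fderiv ℝ f (t, p) (0, w)))
      (fderiv ℝ a p (r p) w - fderiv ℝ a p w (r p)) 0 := by
  have hf1 : DifferentiableAt ℝ f (0, p) := hf.differentiableAt two_ne_zero
  have hf2 : DifferentiableAt ℝ (fderiv ℝ f) (0, p) :=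
    (hf.fderiv_right (m := 1) (by norm_num)).differentiableAt one_ne_zero
  have hsymm : IsSymmSndFDerivAt ℝ f (0, p) := hf.isSymmSndFDerivAt (by simp)
  have hfp : f (0, p) = p := hf0.self_of_nhds
  have hline : HasDerivAt (fun t : ℝ ↦ (t, p)) ((1 : ℝ), (0 : E)) 0 :=
    (hasDerivAt_id (0 : ℝ)).prodMk (hasDerivAt_const _ _)
  have hrow : HasFDerivAt (fun y : E ↦ ((0 : ℝ), y)) (.inr ℝ ℝ E) p := hasFDerivAt_prodMk_right 0 p
  have hfline : HasDerivAt (fun t : ℝ ↦ f (t, p)) (r p) 0 := by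
    have := hf1.hasFDerivAt.comp_hasDerivAt (0 : ℝ) hline
    rwa [hfr.self_of_nhds] at this
  have haf : HasDerivAt (fun t : ℝ ↦ a (f (t, p))) (fderiv ℝ a p (r p)) 0 :=
    ha.hasFDerivAt.comp_hasDerivAt_of_eq (0 : ℝ) hfline hfp.symm
  have hDf0 : fderiv ℝ f (0, p) (0, w) = w := by
    have h1 := (hf1.hasFDerivAt.comp p hrow).unique ((hasFDerivAt_id p).congr_of_eventuallyEq hf0)
    simpa using DFunLike.congr_fun h1 w
  -- Exchanging the mixed partial derivatives turns the time derivative of the spatial differential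
  -- into the spatial derivative of the velocity `r`.
  have hDr : fderiv ℝ (fderiv ℝ f) (0, p) (1, 0) (0, w) = fderiv ℝ r p w := by
    have h1 : HasFDerivAt (fun y : E ↦ fderiv ℝ f (0, y) (1, 0))
        ((ContinuousLinearMap.apply ℝ E ((1 : ℝ), (0 : E))).comp
          ((fderiv ℝ (fderiv ℝ f) (0, p)).comp (.inr ℝ ℝ E))) p :=
      (ContinuousLinearMap.apply ℝ E ((1 : ℝ), (0 : E))).hasFDerivAt.comp p
        (hf2.hasFDerivAt.comp p hrow)
    rw [hsymm, (hr.hasFDerivAt.congr_of_eventuallyEq hfr).unique h1]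
    rfl
  have hDf : HasDerivAt (fun t : ℝ ↦ fderiv ℝ f (t, p) (0, w)) (fderiv ℝ r p w) 0 := by
    rw [← hDr]
    exact (ContinuousLinearMap.apply ℝ E ((0 : ℝ), w)).hasFDerivAt.comp_hasDerivAt (0 : ℝ)
      (hf2.hasFDerivAt.comp_hasDerivAt (0 : ℝ) hline)
  -- This is the vanishing of `d(a(r))` in Cartan's formula, and it eliminates the derivative of
  -- `r`.
  have hconst : fderiv ℝ a p w (r p) + a p (fderiv ℝ r p w) = 0 := by
    have h1 := (ha.hasFDerivAt.clm_apply hr.hasFDerivAt).unique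
      ((hasFDerivAt_const (1 : ℝ) p).congr_of_eventuallyEq har)
    have := DFunLike.congr_fun h1 w
    simp at this
    linarith
  have := haf.clm_apply hDf
  rw [hDf0, hfp] at this
  rwa [sub_eq_add_neg, ← eq_neg_of_add_eq_zero_right hconst]

/-- The operator `v ↦ ι_v ω + a(v) a` attached to a covector `a` and to the antisymmetrization `ω`
of a bilinear form `D`. -/
noncomputable def contactOperator (a : E →L[ℝ] ℝ) (D : E →L[ℝ] E →L[ℝ] ℝ) :
    E →L[ℝ] E →L[ℝ] ℝ :=
  D - D.flip + a.smulRight a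

lemma contactOperator_apply (a : E →L[ℝ] ℝ) (D : E →L[ℝ] E →L[ℝ] ℝ) (v w : E) :
    contactOperator a D v w = D v w - D w v + a v * a w := by
  simp [contactOperator]

lemma ContDiffAt.clm_flip {F : Type*} [NormedAddCommGroup F] [NormedSpace ℝ F]
    {m : WithTop ℕ∞} {D : F → E →L[ℝ] E →L[ℝ] ℝ} {p : F} (hD : ContDiffAt ℝ m D p) :
    ContDiffAt ℝ m (fun y ↦ (D y).flip) p := by
  have h : ContDiff ℝ m (ContinuousLinearMap.flipₗᵢ ℝ E E ℝ) := LinearIsometryEquiv.contDiff _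
  exact ContDiffAt.comp (g := ContinuousLinearMap.flipₗᵢ ℝ E E ℝ) p h.contDiffAt hD

/-- Evaluating `ι_v ω + a(v) a = 0` at `v` kills the antisymmetric part and leaves `a(v)² = 0`;
nondegeneracy on `ker a` then applies. -/
lemma contactOperator_injective {a : E →L[ℝ] ℝ} {D : E →L[ℝ] E →L[ℝ] ℝ}
    (h : ∀ v, a v = 0 → (∀ w, a w = 0 → D v w - D w v = 0) → v = 0) :
    Function.Injective (contactOperator a D) := by
  rw [injective_iff_map_eq_zero]
  intro v hv
  have hv' : ∀ w, D v w - D w v + a v * a w = 0 := fun w ↦ by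
    rw [← contactOperator_apply, hv, zero_apply]
  have hav : a v = 0 := by simpa using hv' v
  exact h v hav fun w _ ↦ by simpa [hav] using hv' w

lemma contactOperator_isInvertible [FiniteDimensional ℝ E] {a : E →L[ℝ] ℝ}
    {D : E →L[ℝ] E →L[ℝ] ℝ}
    (h : ∀ v, a v = 0 → (∀ w, a w = 0 → D v w - D w v = 0) → v = 0) :
    (contactOperator a D).IsInvertible := by
  have hfin : Module.finrank ℝ E = Module.finrank ℝ (E →L[ℝ] ℝ) := by
    rw [← (LinearMap.toContinuousLinearMap (𝕜 := ℝ) (E := E) (F' := ℝ)).finrank_eq]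
    exact Subspace.dual_finrank_eq.symm
  let L := LinearEquiv.ofInjectiveOfFinrankEq (contactOperator a D).toLinearMap
    (contactOperator_injective h) hfin
  exact ⟨L.toContinuousLinearEquiv, by ext; rfl⟩

/-- Solve `ι_v ω + a(v) a = a`. Evaluation at `v` gives `a(v)² = a(v)`, and `a(v) = 0` would force
`v = 0` and then `a = 0`. So `a(v) = 1`, and the equation reduces to `ι_v ω = 0`. -/
lemma exists_reeb_vector [FiniteDimensional ℝ E] {a : E →L[ℝ] ℝ} {D : E →L[ℝ] E →L[ℝ] ℝ}
    (ha : a ≠ 0) (h : ∀ v, a v = 0 → (∀ w, a w = 0 → D v w - D w v = 0) → v = 0) :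
    ∃ v, a v = 1 ∧ ∀ w, D v w - D w v = 0 := by
  obtain ⟨L, hL⟩ := contactOperator_isInvertible h
  have hv : ∀ w, D (L.symm a) w - D w (L.symm a) + a (L.symm a) * a w = a w := fun w ↦ by
    rw [← contactOperator_apply, ← hL]
    simp
  set v := L.symm a
  have hvv : a v * a v = a v := by simpa using hv v
  have hne : a v ≠ 0 := fun h0 ↦ by
    have hv0 : v = 0 := h v h0 fun w hw ↦ by simpa [h0, hw] using hv w
    apply ha
    ext w
    simpa [hv0] using (hv w).symm
  have h1 : a v = 1 := by
    simpa [hne] using hvv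
  exact ⟨v, h1, fun w ↦ by simpa [h1] using hv w⟩

end NormedSpaceForms

/-! ### Reading one-forms and their exterior derivatives in charts. -/

section ContactForms

open Set

variable {n : ℕ} {N : Type*} [TopologicalSpace N] [ChartedSpace (OddModel n) N]
  [IsManifold (𝓡 (2 * n + 1)) ∞ N]
  {α : ∀ x : N, TangentSpace (𝓡 (2 * n + 1)) x →L[ℝ] ℝ}

lemma oneFormInChart_apply_mfderiv {x₀ x : N} (hx : x ∈ (extChartAt (𝓡 (2 * n + 1)) x₀).source)
    (v : TangentSpace (𝓡 (2 * n + 1)) x) :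
    oneFormInChart α x₀ (extChartAt (𝓡 (2 * n + 1)) x₀ x)
      (mfderiv (𝓡 (2 * n + 1)) (𝓡 (2 * n + 1)) (extChartAt (𝓡 (2 * n + 1)) x₀) x v) = α x v := by
  obtain ⟨y, hy, rfl⟩ : ∃ y ∈ (extChartAt (𝓡 (2 * n + 1)) x₀).target,
      (extChartAt (𝓡 (2 * n + 1)) x₀).symm y = x :=
    ⟨_, (extChartAt (𝓡 (2 * n + 1)) x₀).map_source hx,
      (extChartAt (𝓡 (2 * n + 1)) x₀).left_inv hx⟩
  rw [(extChartAt (𝓡 (2 * n + 1)) x₀).right_inv hy]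
  exact congrArg (α _) (mfderiv_extChartAt_symm_apply_mfderiv hy v)

lemma mfderiv_eq_fderiv_comp_symm {E : Type*} [NormedAddCommGroup E] [NormedSpace ℝ E]
    {M : Type*} [TopologicalSpace M] [ChartedSpace E M] {f : M → E} {x : M}
    (hf : MDifferentiableAt 𝓘(ℝ, E) 𝓘(ℝ, E) f x) :
    mfderiv 𝓘(ℝ, E) 𝓘(ℝ, E) f x =
      fderiv ℝ (f ∘ (extChartAt 𝓘(ℝ, E) x).symm) (extChartAt 𝓘(ℝ, E) x x) :=
  hf.mfderiv.trans (by
    simp only [writtenInExtChartAt, extChartAt_model_space_eq_id, modelWithCornersSelf_coe, range_id,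
      fderivWithin_univ]
    rfl)

lemma mdifferentiableAt_extChartAt_of_mem {x₀ x : N}
    (hx : x ∈ (extChartAt (𝓡 (2 * n + 1)) x₀).source) :
    MDifferentiableAt (𝓡 (2 * n + 1)) (𝓡 (2 * n + 1)) (extChartAt (𝓡 (2 * n + 1)) x₀) x :=
  (contMDiffAt_extChartAt' (n := ∞) (by simpa using hx)).mdifferentiableAt (by simp)

lemma mdifferentiableAt_extChartAt_symm_of_mem {x₀ : N} {y : OddModel n}
    (hy : y ∈ (extChartAt (𝓡 (2 * n + 1)) x₀).target) :
    MDifferentiableAt (𝓡 (2 * n + 1)) (𝓡 (2 * n + 1)) (extChartAt (𝓡 (2 * n + 1)) x₀).symm y :=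
  ((contMDiffOn_extChartAt_symm (n := ∞) x₀).contMDiffAt
    ((isOpen_extChartAt_target x₀).mem_nhds hy)).mdifferentiableAt (by simp)

/-- Change of charts for 1-forms. -/
lemma oneFormInChart_eq_pullback {x₀ x₁ : N} {y : OddModel n}
    (hy : y ∈ (extChartAt (𝓡 (2 * n + 1)) x₁).target)
    (hy' : (extChartAt (𝓡 (2 * n + 1)) x₁).symm y ∈ (extChartAt (𝓡 (2 * n + 1)) x₀).source) :
    oneFormInChart α x₁ y =
      (oneFormInChart α x₀ ((extChartAt (𝓡 (2 * n + 1)) x₀ ∘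
        (extChartAt (𝓡 (2 * n + 1)) x₁).symm) y)).comp
      (fderiv ℝ (extChartAt (𝓡 (2 * n + 1)) x₀ ∘ (extChartAt (𝓡 (2 * n + 1)) x₁).symm) y) := by
  rw [← mfderiv_eq_fderiv, mfderiv_comp y (mdifferentiableAt_extChartAt_of_mem hy')
    (mdifferentiableAt_extChartAt_symm_of_mem hy)]
  ext1 w
  exact (oneFormInChart_apply_mfderiv hy' _).symm

/-- The exterior derivative may be computed in any chart. -/
lemma oneFormExtDeriv_eq_of_mem_source {x₀ x : N}
    (hx : x ∈ (extChartAt (𝓡 (2 * n + 1)) x₀).source)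
    (ha : DifferentiableAt ℝ (oneFormInChart α x₀) (extChartAt (𝓡 (2 * n + 1)) x₀ x))
    (v w : TangentSpace (𝓡 (2 * n + 1)) x) :
    oneFormExtDeriv α x v w =
      fderiv ℝ (oneFormInChart α x₀) (extChartAt (𝓡 (2 * n + 1)) x₀ x)
        (mfderiv (𝓡 (2 * n + 1)) (𝓡 (2 * n + 1)) (extChartAt (𝓡 (2 * n + 1)) x₀) x v)
        (mfderiv (𝓡 (2 * n + 1)) (𝓡 (2 * n + 1)) (extChartAt (𝓡 (2 * n + 1)) x₀) x w) -
      fderiv ℝ (oneFormInChart α x₀) (extChartAt (𝓡 (2 * n + 1)) x₀ x)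
        (mfderiv (𝓡 (2 * n + 1)) (𝓡 (2 * n + 1)) (extChartAt (𝓡 (2 * n + 1)) x₀) x w)
        (mfderiv (𝓡 (2 * n + 1)) (𝓡 (2 * n + 1)) (extChartAt (𝓡 (2 * n + 1)) x₀) x v) := by
  set e₀ := extChartAt (𝓡 (2 * n + 1)) x₀
  set e := extChartAt (𝓡 (2 * n + 1)) x with he
  have hsymm : e.symm (e x) = x := extChartAt_to_inv x
  have hev : oneFormInChart α x =ᶠ[𝓝 (e x)] fun y ↦
      (oneFormInChart α x₀ ((e₀ ∘ e.symm) y)).comp (fderiv ℝ (e₀ ∘ e.symm) y) := by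
    have h1 : ∀ᶠ y in 𝓝 (e x), e.symm y ∈ e₀.source :=
      (continuousAt_extChartAt_symm x).eventually
        ((isOpen_extChartAt_source x₀).mem_nhds (by rw [← he, hsymm]; exact hx))
    filter_upwards [extChartAt_target_mem_nhds (I := 𝓡 (2 * n + 1)) x, h1] with y hy hy'
    exact oneFormInChart_eq_pullback hy hy'
  have hφ : ContDiffAt ℝ 2 (e₀ ∘ e.symm) (e x) := by
    rw [← contMDiffAt_iff_contDiffAt]
    have h1 : ContMDiffAt (𝓡 (2 * n + 1)) (𝓡 (2 * n + 1)) ∞ e₀ x :=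
      contMDiffAt_extChartAt' (by simpa [e₀] using hx)
    have h2 : ContMDiffAt (𝓡 (2 * n + 1)) (𝓡 (2 * n + 1)) ∞ e.symm (e x) :=
      (contMDiffOn_extChartAt_symm x).contMDiffAt (extChartAt_target_mem_nhds x)
    exact (h1.comp_of_eq h2 hsymm).of_le (by norm_cast)
  have hT := mfderiv_eq_fderiv_comp_symm (mdifferentiableAt_extChartAt_of_mem hx)
  have hφx : (e₀ ∘ e.symm) (e x) = e₀ x := congrArg e₀ hsymm
  have := fderiv_pullback_antisymm (a := oneFormInChart α x₀) (f := e₀ ∘ e.symm) (p := e x)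
    (by rwa [hφx]) hφ v w
  rw [hφx, ← hev.fderiv_eq] at this
  rw [hT]
  exact this

/-- The trivialization of the cotangent bundle at `x₀` reads `α` through the differential of the
inverse chart, so smoothness as a section is smoothness of this local expression. -/
lemma contDiffAt_oneFormInChart (hα : IsContactForm α) (x₀ : N) :
    ContDiffAt ℝ ∞ (oneFormInChart α x₀) (extChartAt (𝓡 (2 * n + 1)) x₀ x₀) := by
  have h := ((contMDiffAt_hom_bundle _).mp (hα.smooth x₀)).2
  rw [← contMDiffAt_iff_contDiffAt]
  have h2 : ContMDiffAt (𝓡 (2 * n + 1)) (𝓡 (2 * n + 1)) ∞ (extChartAt (𝓡 (2 * n + 1)) x₀).symm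
      (extChartAt (𝓡 (2 * n + 1)) x₀ x₀) :=
    (contMDiffOn_extChartAt_symm x₀).contMDiffAt (extChartAt_target_mem_nhds x₀)
  refine (h.comp_of_eq h2 (extChartAt_to_inv x₀)).congr_of_eventuallyEq ?_
  filter_upwards [extChartAt_target_mem_nhds (I := 𝓡 (2 * n + 1)) x₀] with y hy
  ext1 w
  have hs : (extChartAt (𝓡 (2 * n + 1)) x₀).symm y ∈ (chartAt (OddModel n) x₀).source := by
    simpa using (extChartAt (𝓡 (2 * n + 1)) x₀).map_target hy
  have h3 := DFunLike.congr_fun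
    (TangentBundle.symmL_trivializationAt (𝕜 := ℝ) (I := 𝓡 (2 * n + 1)) hs) w
  rw [(extChartAt (𝓡 (2 * n + 1)) x₀).right_inv hy, modelWithCornersSelf_coe, range_id,
    mfderivWithin_univ] at h3
  refine (congrArg (α ((extChartAt (𝓡 (2 * n + 1)) x₀).symm y)) h3.symm).trans ?_
  exact (DFunLike.congr_fun (Bundle.Trivial.continuousLinearMapAt_trivialization ℝ N ℝ
    ((extChartAt (𝓡 (2 * n + 1)) x₀).symm y)) _).symm

end ContactForms

/-! ### Smoothness of the Reeb field and invariance of the contact form. -/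

section ReebFlow

open Set

variable {n : ℕ} {N : Type*} [TopologicalSpace N] [ChartedSpace (OddModel n) N]
  [IsManifold (𝓡 (2 * n + 1)) ∞ N]
  {α : ∀ x : N, TangentSpace (𝓡 (2 * n + 1)) x →L[ℝ] ℝ}

/-- Tangent vectors at `x` are by definition their coordinates in the preferred chart at `x`. -/
lemma mfderiv_extChartAt_self_apply (x : N) (v : TangentSpace (𝓡 (2 * n + 1)) x) :
    (mfderiv (𝓡 (2 * n + 1)) (𝓡 (2 * n + 1)) (extChartAt (𝓡 (2 * n + 1)) x) x v : OddModel n) =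
      v := by
  have h : (extChartAt (𝓡 (2 * n + 1)) x) ∘ (extChartAt (𝓡 (2 * n + 1)) x).symm
      =ᶠ[𝓝 (extChartAt (𝓡 (2 * n + 1)) x x)] id := by
    filter_upwards [extChartAt_target_mem_nhds (I := 𝓡 (2 * n + 1)) x] with y hy
    exact (extChartAt (𝓡 (2 * n + 1)) x).right_inv hy
  have h1 := mfderiv_eq_fderiv_comp_symm
    (mdifferentiableAt_extChartAt_of_mem (mem_extChartAt_source (I := 𝓡 (2 * n + 1)) x))
  rw [h.fderiv_eq, fderiv_id] at h1
  exact DFunLike.congr_fun h1 v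

lemma oneFormInChart_self_apply (x : N) (v : TangentSpace (𝓡 (2 * n + 1)) x) :
    oneFormInChart α x (extChartAt (𝓡 (2 * n + 1)) x x) v = α x v := by
  refine Eq.trans ?_ (oneFormInChart_apply_mfderiv (mem_extChartAt_source x) v)
  exact congrArg (oneFormInChart α x (extChartAt (𝓡 (2 * n + 1)) x x))
    (mfderiv_extChartAt_self_apply x v).symm

lemma reebField_spec (hα : IsContactForm α) (x : N) :
    α x (reebField α x) = 1 ∧ ∀ w, oneFormExtDeriv α x (reebField α x) w = 0 :=
  Classical.epsilon_spec (p := fun v : TangentSpace (𝓡 (2 * n + 1)) x ↦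
    α x v = 1 ∧ ∀ w : TangentSpace (𝓡 (2 * n + 1)) x, oneFormExtDeriv α x v w = 0)
    (exists_reeb_vector (E := OddModel n) (a := α x)
      (D := fderiv ℝ (oneFormInChart α x) (extChartAt (𝓡 (2 * n + 1)) x x))
      (hα.ne_zero x) (hα.nondegenerate x))

/-- The Reeb vector field of a contact form is smooth. -/
theorem contMDiff_reebField (hα : IsContactForm α) :
    ContMDiff (𝓡 (2 * n + 1)) (𝓡 (2 * n + 1)).tangent ∞
      (fun x ↦ (⟨x, reebField α x⟩ : TangentBundle (𝓡 (2 * n + 1)) N)) := by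
  intro x₀
  have hI1 : IsManifold (𝓡 (2 * n + 1)) 1 N := .of_le (n := ∞) (by norm_cast)
  rw [contMDiffAt_vectorField_iff]
  let e := extChartAt (𝓡 (2 * n + 1)) x₀
  let a : OddModel n → OddModel n →L[ℝ] ℝ := oneFormInChart α x₀
  let L : OddModel n → OddModel n →L[ℝ] OddModel n →L[ℝ] ℝ := fun y ↦
    contactOperator (a y) (fderiv ℝ a y)
  have ha : ContDiffAt ℝ ∞ a (e x₀) := contDiffAt_oneFormInChart hα x₀
  have hDa : ContDiffAt ℝ ∞ (fderiv ℝ a) (e x₀) := ha.fderiv_right (by simp)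
  have hL : ContDiffAt ℝ ∞ L (e x₀) := (hDa.sub hDa.clm_flip).add (ha.smulRight ha)
  have hinv₀ : (L (e x₀)).IsInvertible := contactOperator_isInvertible fun v hv h ↦
    hα.nondegenerate x₀ v ((oneFormInChart_self_apply x₀ v).symm.trans hv) fun w hw ↦
      h w ((oneFormInChart_self_apply x₀ w).trans hw)
  -- In the chart, the Reeb field is the solution of `L y v = a y`, and inversion is smooth at an
  -- invertible operator.
  have hG : ContDiffAt ℝ ∞ (fun y ↦ (L y).inverse (a y)) (e x₀) := by
    obtain ⟨L₀, hL₀⟩ := hinv₀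
    have : ContDiffAt ℝ ∞ (ContinuousLinearMap.inverse (R := ℝ) (M := OddModel n)
        (M₂ := OddModel n →L[ℝ] ℝ)) (L (e x₀)) := hL₀ ▸ contDiffAt_map_inverse L₀
    exact (this.comp (e x₀) hL).clm_apply ha
  have he : ContMDiffAt (𝓡 (2 * n + 1)) (𝓡 (2 * n + 1)) ∞ e x₀ := contMDiffAt_extChartAt
  refine (hG.contMDiffAt.comp x₀ he).congr_of_eventuallyEq ?_
  have hev1 : ∀ᶠ y in 𝓝 (e x₀), (L y).IsInvertible := by
    obtain ⟨L₀, hL₀⟩ := hinv₀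
    have : ∀ᶠ A in 𝓝 (L (e x₀)), A.IsInvertible := hL₀ ▸ L₀.nhds
    exact hL.continuousAt.eventually this
  have hev2 : ∀ᶠ y in 𝓝 (e x₀), DifferentiableAt ℝ a y :=
    ((ha.of_le (m := 1) (by norm_cast)).eventually (by simp)).mono
      fun y hy ↦ hy.differentiableAt one_ne_zero
  have hec : ContinuousAt e x₀ := continuousAt_extChartAt x₀
  filter_upwards [hec.eventually hev1, hec.eventually hev2,
    extChartAt_source_mem_nhds (I := 𝓡 (2 * n + 1)) x₀] with x hx1 hx2 hx3
  symm
  refine hx1.inverse_apply_eq.mpr ?_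
  ext w
  have hT : (mfderiv (𝓡 (2 * n + 1)) (𝓡 (2 * n + 1)) e x).IsInvertible :=
    isInvertible_mfderiv_extChartAt hx3
  obtain ⟨u, rfl⟩ := hT.bijective.surjective w
  have hR := reebField_spec hα x
  have h1 := oneFormExtDeriv_eq_of_mem_source hx3 hx2 (reebField α x) u
  rw [hR.2 u] at h1
  have h2 := oneFormInChart_apply_mfderiv (α := α) hx3 (reebField α x)
  rw [hR.1] at h2
  refine Eq.trans ?_ (contactOperator_apply _ _ _ _).symm
  exact (by rw [h2, one_mul]; linarith [h1])

/-- A flow of the Reeb vector field preserves the contact form. -/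
theorem pairing_mfderiv_reeb_flow (hα : IsContactForm α) {φ : ℝ → N → N}
    (hφ : ContMDiff (𝓘(ℝ, ℝ).prod (𝓡 (2 * n + 1))) (𝓡 (2 * n + 1)) ∞
      (fun p : ℝ × N ↦ φ p.1 p.2))
    (hφ0 : ∀ x, φ 0 x = x) (hφadd : ∀ s t x, φ (s + t) x = φ s (φ t x))
    (hφR : ∀ x, IsMIntegralCurve (I := 𝓡 (2 * n + 1)) (fun t ↦ φ t x) (reebField α))
    (t : ℝ) (x : N) (w : TangentSpace (𝓡 (2 * n + 1)) x) :
    α (φ t x) (mfderiv (𝓡 (2 * n + 1)) (𝓡 (2 * n + 1)) (φ t) x w) = α x w := by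
  have hφt : ∀ t, ContMDiff (𝓡 (2 * n + 1)) (𝓡 (2 * n + 1)) ∞ (φ t) := fun t ↦
    hφ.comp (contMDiff_const.prodMk contMDiff_id)
  have hφd : ∀ t, MDifferentiable (𝓡 (2 * n + 1)) (𝓡 (2 * n + 1)) (φ t) := fun t ↦
    (hφt t).mdifferentiable (by simp)
  -- It suffices to differentiate at time `0`, for every point and every vector: the group law
  -- carries the result to all times.
  have hzero : ∀ (x : N) (w : TangentSpace (𝓡 (2 * n + 1)) x),
      HasDerivAt (fun t : ℝ ↦
        α (φ t x) (mfderiv (𝓡 (2 * n + 1)) (𝓡 (2 * n + 1)) (φ t) x w)) 0 0 := by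
    intro x w
    let e := extChartAt (𝓡 (2 * n + 1)) x
    let a : OddModel n → OddModel n →L[ℝ] ℝ := oneFormInChart α x
    let f : ℝ × OddModel n → OddModel n := fun q ↦ e (φ q.1 (e.symm q.2))
    let r : OddModel n → OddModel n := fun y ↦
      mfderiv (𝓡 (2 * n + 1)) (𝓡 (2 * n + 1)) e (e.symm y) (reebField α (e.symm y))
    have hsymm : e.symm (e x) = x := extChartAt_to_inv x
    have he : ContMDiffAt (𝓡 (2 * n + 1)) (𝓡 (2 * n + 1)) ∞ e x := contMDiffAt_extChartAt
    have hesymm : ContMDiffAt (𝓡 (2 * n + 1)) (𝓡 (2 * n + 1)) ∞ e.symm (e x) :=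
      (contMDiffOn_extChartAt_symm x).contMDiffAt (extChartAt_target_mem_nhds x)
    have ha : DifferentiableAt ℝ a (e x) :=
      (contDiffAt_oneFormInChart hα x).differentiableAt (by simp)
    have hr : DifferentiableAt ℝ r (e x) := by
      have h1 := (contMDiffAt_vectorField_iff.mp (contMDiff_reebField hα x)).comp_of_eq hesymm hsymm
      exact (contMDiffAt_iff_contDiffAt.mp h1).differentiableAt (by simp)
    have hf : ContDiffAt ℝ ∞ f (0, e x) := by
      rw [← contMDiffAt_iff_contDiffAt]
      have h1 : ContMDiffAt 𝓘(ℝ, ℝ × OddModel n) (𝓡 (2 * n + 1)) ∞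
          (fun q : ℝ × OddModel n ↦ e.symm q.2) (0, e x) :=
        hesymm.comp_of_eq contDiffAt_snd.contMDiffAt rfl
      have h2 : ContMDiffAt 𝓘(ℝ, ℝ × OddModel n) (𝓡 (2 * n + 1)) ∞
          (fun q : ℝ × OddModel n ↦ φ q.1 (e.symm q.2)) (0, e x) :=
        hφ.contMDiffAt.comp _ (contDiffAt_fst.contMDiffAt.prodMk h1)
      exact he.comp_of_eq h2 ((hφ0 _).trans hsymm)
    have hf0 : ∀ᶠ y in 𝓝 (e x), f (0, y) = y := by
      filter_upwards [extChartAt_target_mem_nhds (I := 𝓡 (2 * n + 1)) x] with y hy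
      simp only [f, hφ0]
      exact e.right_inv hy
    have hfd : ∀ᶠ q in 𝓝 ((0 : ℝ), e x), DifferentiableAt ℝ f q :=
      ((hf.of_le (m := 1) (by norm_cast)).eventually (by simp)).mono
        fun y hy ↦ hy.differentiableAt one_ne_zero
    have hfr : ∀ᶠ y in 𝓝 (e x), fderiv ℝ f (0, y) (1, 0) = r y := by
      have h1 : ∀ᶠ y in 𝓝 (e x), DifferentiableAt ℝ f (0, y) :=
        (Continuous.prodMk_right (0 : ℝ)).continuousAt.eventually hfd
      filter_upwards [h1, extChartAt_target_mem_nhds (I := 𝓡 (2 * n + 1)) x] with y hy1 hy2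
      have hline : HasDerivAt (fun t : ℝ ↦ (t, y)) ((1 : ℝ), (0 : OddModel n)) 0 :=
        (hasDerivAt_id (0 : ℝ)).prodMk (hasDerivAt_const (0 : ℝ) y)
      have h2 : HasDerivAt (fun t : ℝ ↦ f (t, y)) (fderiv ℝ f (0, y) (1, 0)) 0 := by
        have := hy1.hasFDerivAt.comp_hasDerivAt (0 : ℝ) hline
        exact this
      have hmem : φ 0 (e.symm y) ∈ e.source := by
        rw [hφ0]
        exact e.map_target hy2
      have h3 := ((mdifferentiableAt_extChartAt_of_mem hmem).hasMFDerivAt.comp (0 : ℝ)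
        (hφR (e.symm y) 0)).hasFDerivAt
      have h4 := h2.hasFDerivAt.unique h3
      -- The points `φ 0 (e.symm y)` and `e.symm y` are only propositionally equal, so the dependent
      -- expression is transported with the base point generalized.
      have h5 : ∀ z z', z = z' → (mfderiv (𝓡 (2 * n + 1)) (𝓡 (2 * n + 1)) e z (reebField α z) :
          OddModel n) = mfderiv (𝓡 (2 * n + 1)) (𝓡 (2 * n + 1)) e z' (reebField α z') := by
        rintro z _ rfl
        rfl
      refine Eq.trans ?_ (h5 _ _ (hφ0 (e.symm y)))
      have h6 := DFunLike.congr_fun h4 (1 : ℝ)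
      rw [ContinuousLinearMap.toSpanSingleton_apply, one_smul] at h6
      refine h6.trans (congrArg (mfderiv (𝓡 (2 * n + 1)) (𝓡 (2 * n + 1)) e (φ 0 (e.symm y))) ?_)
      exact one_smul ℝ (reebField α (φ 0 (e.symm y)))
    have har : ∀ᶠ y in 𝓝 (e x), a y (r y) = 1 := by
      filter_upwards [extChartAt_target_mem_nhds (I := 𝓡 (2 * n + 1)) x] with y hy
      have h1 := oneFormInChart_apply_mfderiv (α := α) (e.map_target hy) (reebField α (e.symm y))
      rw [(reebField_spec hα _).1, e.right_inv hy] at h1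
      exact h1
    have hrx : r (e x) = reebField α x := by
      have h1 : ∀ z, z = x → (mfderiv (𝓡 (2 * n + 1)) (𝓡 (2 * n + 1)) e z (reebField α z) :
          OddModel n) = reebField α x := by
        rintro z rfl
        exact mfderiv_extChartAt_self_apply z _
      exact h1 _ hsymm
    have hd := hasDerivAt_pairing_flow ha hr (hf.of_le (by norm_cast)) hf0 hfr har w
    have hval : fderiv ℝ a (e x) (r (e x)) w - fderiv ℝ a (e x) w (r (e x)) = 0 := by
      rw [hrx]
      exact (reebField_spec hα x).2 w
    rw [hval] at hd
    refine hd.congr_of_eventuallyEq ?_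
    have hev1 : ∀ᶠ t in 𝓝 (0 : ℝ), DifferentiableAt ℝ f (t, e x) :=
      (Continuous.prodMk_left (e x)).continuousAt.eventually hfd
    have hev2 : ∀ᶠ t in 𝓝 (0 : ℝ), φ t x ∈ e.source := by
      have h1 : ContinuousAt (fun t ↦ φ t x) 0 := (hφR x 0).continuousAt
      exact h1.eventually ((isOpen_extChartAt_source x).mem_nhds
        (by simp [hφ0]))
    filter_upwards [hev1, hev2] with t ht1 ht2
    have h1 := oneFormInChart_apply_mfderiv (α := α) ht2
      (mfderiv (𝓡 (2 * n + 1)) (𝓡 (2 * n + 1)) (φ t) x w)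
    have h2 : HasFDerivAt (fun y ↦ f (t, y)) ((fderiv ℝ f (t, e x)).comp (.inr ℝ ℝ _)) (e x) :=
      ht1.hasFDerivAt.comp (e x) (hasFDerivAt_prodMk_right t (e x))
    have h3 := mfderiv_comp x (mdifferentiableAt_extChartAt_of_mem ht2) (hφd t x)
    rw [mfderiv_eq_fderiv_comp_symm
      ((mdifferentiableAt_extChartAt_of_mem ht2).comp x (hφd t x))] at h3
    have h4 := DFunLike.congr_fun (h2.fderiv.symm.trans h3) w
    have h5 : f (t, e x) = e (φ t x) := congrArg (fun z ↦ e (φ t z)) hsymm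
    rw [h5]
    exact h1.symm.trans (congrArg (a (e (φ t x))) h4.symm)
  set G : ℝ → ℝ := fun t ↦ α (φ t x) (mfderiv (𝓡 (2 * n + 1)) (𝓡 (2 * n + 1)) (φ t) x w) with hG
  have hderiv : ∀ t, HasDerivAt G 0 t := by
    intro t
    have hshift : ∀ s, α (φ s (φ t x)) (mfderiv (𝓡 (2 * n + 1)) (𝓡 (2 * n + 1)) (φ s) (φ t x)
        (mfderiv (𝓡 (2 * n + 1)) (𝓡 (2 * n + 1)) (φ t) x w)) =
        G (s + t) := by
      intro s
      simp only [hG]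
      have h1 : φ (s + t) = φ s ∘ φ t := funext (hφadd s t)
      rw [h1]
      exact congrArg (α (φ s (φ t x)))
        (DFunLike.congr_fun (mfderiv_comp x (hφd s (φ t x)) (hφd t x)) w).symm
    have h1 := hzero (φ t x) (mfderiv (𝓡 (2 * n + 1)) (𝓡 (2 * n + 1)) (φ t) x w)
    simp only [hshift] at h1
    rw [← sub_self t] at h1
    simpa using h1.comp_sub_const t t
  have hconst := is_const_of_deriv_eq_zero (fun t ↦ (hderiv t).differentiableAt)
    (fun t ↦ (hderiv t).deriv) t 0
  refine hconst.trans ?_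
  simp only [hG]
  have h0 : φ 0 = id := funext hφ0
  rw [h0]
  exact congrArg (α x) (DFunLike.congr_fun (mfderiv_id (I := 𝓡 (2 * n + 1)) (x := x)) w)

end ReebFlow

/-! ### The Reeb flow as contactomorphisms, and Hamiltonians of composed paths. -/

section ReebTimeMaps

open Set

variable {n : ℕ} {N : Type*} [TopologicalSpace N] [ChartedSpace (OddModel n) N]
  {α : ∀ x : N, TangentSpace (𝓡 (2 * n + 1)) x →L[ℝ] ℝ}

/-- On a closed manifold the maps `reebFlow α t` form a smooth flow of the Reeb vector field. -/
theorem reebFlow_isFlow [IsManifold (𝓡 (2 * n + 1)) ∞ N] [T2Space N] [CompactSpace N]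
    (hα : IsContactForm α) :
    ContMDiff (𝓘(ℝ, ℝ).prod (𝓡 (2 * n + 1))) (𝓡 (2 * n + 1)) ∞
      (fun p : ℝ × N ↦ reebFlow α p.1 p.2) ∧
    (∀ x, reebFlow α 0 x = x) ∧
    (∀ s t x, reebFlow α (s + t) x = reebFlow α s (reebFlow α t x)) ∧
    ∀ x, IsMIntegralCurve (I := 𝓡 (2 * n + 1)) (fun t ↦ reebFlow α t x) (reebField α) := by
  have hI1 : IsManifold (𝓡 (2 * n + 1)) 1 N := .of_le (n := ∞) (by norm_cast)
  have hR := contMDiff_reebField hα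
  obtain ⟨φ, hφ, hφ0, hφadd, hφR⟩ := exists_contMDiff_flow hR
  have hφt : ∀ t, ContMDiff (𝓡 (2 * n + 1)) (𝓡 (2 * n + 1)) ∞ (φ t) := fun t ↦
    hφ.comp (contMDiff_const.prodMk contMDiff_id)
  let Φ : ℝ → N ≃ₘ⟮𝓡 (2 * n + 1), 𝓡 (2 * n + 1)⟯ N := fun t ↦
    { toFun := φ t
      invFun := φ (-t)
      left_inv := fun x ↦ by rw [← hφadd, neg_add_cancel, hφ0]
      right_inv := fun x ↦ by rw [← hφadd, add_neg_cancel, hφ0]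
      contMDiff_toFun := hφt t
      contMDiff_invFun := hφt (-t) }
  -- The constructed flow shows that the choice in `reebFlow` is not vacuous, and uniqueness of
  -- integral curves identifies the chosen map with it.
  have heq : ∀ t x, reebFlow α t x = φ t x := by
    intro t x
    have hspec : IsReebTimeMap α t (reebFlow α t) :=
      Classical.epsilon_spec (p := IsReebTimeMap α t)
        ⟨Φ t, fun x ↦ ⟨fun s ↦ φ s x, hφR x, hφ0 x, rfl⟩⟩
    obtain ⟨γ, hγ, hγ0, hγt⟩ := hspec x
    have := isMIntegralCurve_Ioo_eq_of_contMDiff_boundaryless (t₀ := 0)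
      (hR.of_le (by norm_cast)) hγ (hφR x) (by rw [hγ0, hφ0])
    rw [← hγt, this]
  simp only [heq]
  exact ⟨hφ, hφ0, hφadd, hφR⟩

lemma IsContactomorphism.trans {χ ψ : N ≃ₘ⟮𝓡 (2 * n + 1), 𝓡 (2 * n + 1)⟯ N}
    (hχ : IsContactomorphism α χ) (hψ : IsContactomorphism α ψ) :
    IsContactomorphism α (χ.trans ψ) := by
  intro x v
  have h1 : mfderiv (𝓡 (2 * n + 1)) (𝓡 (2 * n + 1)) (χ.trans ψ) x v =
      mfderiv (𝓡 (2 * n + 1)) (𝓡 (2 * n + 1)) ψ (χ x)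
        (mfderiv (𝓡 (2 * n + 1)) (𝓡 (2 * n + 1)) χ x v) :=
    DFunLike.congr_fun (mfderiv_comp x (ψ.mdifferentiable (by simp) (χ x))
      (χ.mdifferentiable (by simp) x)) v
  rw [h1]
  exact ⟨(hψ _ _).1.trans (hχ x v).1, (hψ _ _).2.trans (hχ x v).2⟩

lemma IsContactomorphism.symm {ψ : N ≃ₘ⟮𝓡 (2 * n + 1), 𝓡 (2 * n + 1)⟯ N}
    (hψ : IsContactomorphism α ψ) : IsContactomorphism α ψ.symm := by
  intro x v
  set u := mfderiv (𝓡 (2 * n + 1)) (𝓡 (2 * n + 1)) ψ.symm x v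
  have hid : ψ ∘ ψ.symm = id := funext ψ.apply_symm_apply
  have h1 : α ((ψ ∘ ψ.symm) x) (mfderiv (𝓡 (2 * n + 1)) (𝓡 (2 * n + 1)) (ψ ∘ ψ.symm) x v) =
      α x v := by
    rw [hid]
    exact congrArg (α x) (DFunLike.congr_fun (mfderiv_id (I := 𝓡 (2 * n + 1)) (x := x)) v)
  have h2 : α (ψ (ψ.symm x)) (mfderiv (𝓡 (2 * n + 1)) (𝓡 (2 * n + 1)) ψ (ψ.symm x) u) = α x v :=
    (congrArg (α (ψ (ψ.symm x))) (DFunLike.congr_fun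
      (mfderiv_comp x (ψ.mdifferentiable (by simp) (ψ.symm x))
        (ψ.symm.mdifferentiable (by simp) x)) v).symm).trans h1
  have h3 := hψ (ψ.symm x) u
  rw [h2] at h3
  exact ⟨h3.1.symm, h3.2.symm⟩

lemma pairing_mfderiv_reebFlow [IsManifold (𝓡 (2 * n + 1)) ∞ N] [T2Space N] [CompactSpace N]
    (hα : IsContactForm α) (t : ℝ) (x : N) (w : TangentSpace (𝓡 (2 * n + 1)) x) :
    α (reebFlow α t x) (mfderiv (𝓡 (2 * n + 1)) (𝓡 (2 * n + 1)) (reebFlow α t) x w) = α x w := by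
  obtain ⟨h1, h2, h3, h4⟩ := reebFlow_isFlow hα
  exact pairing_mfderiv_reeb_flow hα h1 h2 h3 h4 t x w

lemma isContactomorphism_reebFlow [IsManifold (𝓡 (2 * n + 1)) ∞ N] [T2Space N] [CompactSpace N]
    (hα : IsContactForm α) (t : ℝ) : IsContactomorphism α (reebFlow α t) := by
  intro x v
  rw [pairing_mfderiv_reebFlow hα]
  exact ⟨Iff.rfl, Iff.rfl⟩

/-- The contact Hamiltonian of an isotopy, pulled back along the isotopy. -/
noncomputable def isotopyPairing (α : ∀ x : N, TangentSpace (𝓡 (2 * n + 1)) x →L[ℝ] ℝ)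
    (Ψ : ℝ → N ≃ₘ⟮𝓡 (2 * n + 1), 𝓡 (2 * n + 1)⟯ N) (t : ℝ) (x : N) : ℝ :=
  α (Ψ t x) (isotopyVelocity Ψ t x)

/-- Each `Ψ t` is a bijection, so extrema may be taken after pulling back; this removes `(Ψ t).symm`
from all later estimates. -/
lemma iSup_abs_contactHamiltonian (Ψ : ℝ → N ≃ₘ⟮𝓡 (2 * n + 1), 𝓡 (2 * n + 1)⟯ N) (t : ℝ) :
    ⨆ y, |contactHamiltonian α Ψ t y| = ⨆ x, |isotopyPairing α Ψ t x| :=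
  (Ψ t).symm.toEquiv.iSup_comp (g := fun x ↦ |isotopyPairing α Ψ t x|)

lemma iSup_contactHamiltonian (Ψ : ℝ → N ≃ₘ⟮𝓡 (2 * n + 1), 𝓡 (2 * n + 1)⟯ N) (t : ℝ) :
    ⨆ y, contactHamiltonian α Ψ t y = ⨆ x, isotopyPairing α Ψ t x :=
  (Ψ t).symm.toEquiv.iSup_comp (g := fun x ↦ isotopyPairing α Ψ t x)

lemma iInf_contactHamiltonian (Ψ : ℝ → N ≃ₘ⟮𝓡 (2 * n + 1), 𝓡 (2 * n + 1)⟯ N) (t : ℝ) :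
    ⨅ y, contactHamiltonian α Ψ t y = ⨅ x, isotopyPairing α Ψ t x :=
  (Ψ t).symm.toEquiv.iInf_comp (g := fun x ↦ isotopyPairing α Ψ t x)

lemma IsContactIsotopy.hasMFDerivWithinAt
    {Ψ : ℝ → N ≃ₘ⟮𝓡 (2 * n + 1), 𝓡 (2 * n + 1)⟯ N} (hΨ : IsContactIsotopy α Ψ) {t : ℝ}
    (ht : t ∈ Icc (0 : ℝ) 1) (x : N) :
    HasMFDerivWithinAt 𝓘(ℝ, ℝ) (𝓡 (2 * n + 1)) (fun s ↦ Ψ s x) (Icc 0 1) t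
      ((1 : ℝ →L[ℝ] ℝ).smulRight (isotopyVelocity Ψ t x)) := by
  have h1 : MDifferentiableWithinAt 𝓘(ℝ, ℝ) (𝓡 (2 * n + 1)) (fun s ↦ Ψ s x) (Icc 0 1) t := by
    have h2 : ContMDiffOn 𝓘(ℝ, ℝ) (𝓡 (2 * n + 1)) ∞ (fun s ↦ Ψ s x) (Icc 0 1) :=
      hΨ.smooth.comp (contMDiff_id.prodMk contMDiff_const).contMDiffOn
        fun s hs ↦ ⟨hs, mem_univ _⟩
    exact (h2 t ht).mdifferentiableWithinAt (by simp)
  refine h1.hasMFDerivWithinAt.congr_mfderiv (ContinuousLinearMap.ext fun (a : ℝ) ↦ ?_)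
  have h3 := map_smul (mfderivWithin 𝓘(ℝ, ℝ) (𝓡 (2 * n + 1)) (fun s ↦ Ψ s x) (Icc 0 1) t)
    a (1 : ℝ)
  refine Eq.trans (congrArg _ ?_) h3
  exact (mul_one a).symm

/-- Joint continuity of the Hamiltonian. -/
lemma IsContactIsotopy.continuousOn_isotopyPairing [IsManifold (𝓡 (2 * n + 1)) ∞ N]
    (hα : IsContactForm α)
    {Ψ : ℝ → N ≃ₘ⟮𝓡 (2 * n + 1), 𝓡 (2 * n + 1)⟯ N} (hΨ : IsContactIsotopy α Ψ) :
    ContinuousOn (fun p : ℝ × N ↦ isotopyPairing α Ψ p.1 p.2) (Icc 0 1 ×ˢ univ) := by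
  have hI1 : IsManifold (𝓡 (2 * n + 1)) 1 N := .of_le (n := ∞) (by norm_cast)
  have hA : Continuous fun q : TangentBundle (𝓡 (2 * n + 1)) N ↦ α q.1 q.2 := by
    have h1 : ContMDiff (𝓡 (2 * n + 1)).tangent
        ((𝓡 (2 * n + 1)).prod 𝓘(ℝ, OddModel n →L[ℝ] ℝ)) ∞
        (fun q : TangentBundle (𝓡 (2 * n + 1)) N ↦ Bundle.TotalSpace.mk' (OddModel n →L[ℝ] ℝ)
          (E := fun x : N ↦ TangentSpace (𝓡 (2 * n + 1)) x →L[ℝ] Bundle.Trivial N ℝ x)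
          q.1 (α q.1)) :=
      hα.smooth.comp (Bundle.contMDiff_proj (TangentSpace (𝓡 (2 * n + 1))))
    have hid : ContMDiff (𝓡 (2 * n + 1)).tangent ((𝓡 (2 * n + 1)).prod 𝓘(ℝ, OddModel n)) ∞
        (fun q : TangentBundle (𝓡 (2 * n + 1)) N ↦ Bundle.TotalSpace.mk' (OddModel n) q.1 q.2) :=
      contMDiff_id
    have h2 := ContMDiff.clm_bundle_apply (F₂ := ℝ) (E₂ := Bundle.Trivial N ℝ) h1 hid
    exact ((Bundle.Trivial.homeomorphProd N ℝ).continuous.comp h2.continuous).snd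
  have hu : UniqueMDiffOn (𝓘(ℝ, ℝ).prod (𝓡 (2 * n + 1))) (Icc (0 : ℝ) 1 ×ˢ (univ : Set N)) :=
    (uniqueDiffOn_Icc_zero_one.uniqueMDiffOn).prod uniqueMDiffOn_univ
  have hT := hΨ.smooth.continuousOn_tangentMapWithin (by norm_cast) hu
  -- The unit vector field in the time direction: the tangent map of `(t, x) ↦ Ψ t x` sends it to
  -- the velocity of the isotopy, so the pairing is a composite of continuous maps.
  let σ : ℝ × N → TangentBundle (𝓘(ℝ, ℝ).prod (𝓡 (2 * n + 1))) (ℝ × N) := fun p ↦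
    ⟨p, ((1 : ℝ), (0 : OddModel n))⟩
  have hσ : Continuous σ := by
    have h1 : Continuous fun p : ℝ × N ↦ (⟨p.1, (1 : ℝ)⟩ : TangentBundle 𝓘(ℝ, ℝ) ℝ) :=
      (tangentBundleModelSpaceHomeomorph 𝓘(ℝ, ℝ)).symm.continuous.comp
        (continuous_fst.prodMk continuous_const)
    have h2 : Continuous fun p : ℝ × N ↦
        (⟨p.2, (0 : OddModel n)⟩ : TangentBundle (𝓡 (2 * n + 1)) N) :=
      (Bundle.contMDiff_zeroSection ℝ (TangentSpace (𝓡 (2 * n + 1))) (IB := 𝓡 (2 * n + 1))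
        (n := 1)).continuous.comp continuous_snd
    exact (contMDiff_equivTangentBundleProd_symm (n := 0)).continuous.comp (h1.prodMk h2)
  refine (hA.comp_continuousOn (hT.comp hσ.continuousOn fun p hp ↦ hp)).congr fun p hp ↦ ?_
  have hmem : MapsTo (fun s : ℝ ↦ (s, p.2)) (Icc 0 1) (Icc (0 : ℝ) 1 ×ˢ (univ : Set N)) :=
    fun s hs ↦ ⟨hs, mem_univ _⟩
  have h1 := ((hΨ.smooth p hp).mdifferentiableWithinAt (by simp)).hasMFDerivWithinAt
  have h2 : HasMFDerivWithinAt 𝓘(ℝ, ℝ) (𝓘(ℝ, ℝ).prod (𝓡 (2 * n + 1)))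
      (fun s : ℝ ↦ (s, p.2)) (Icc 0 1) p.1 _ :=
    (hasMFDerivWithinAt_id _ _).prodMk (hasMFDerivWithinAt_const p.2 _ _)
  have h3 := (uniqueDiffOn_Icc_zero_one.uniqueMDiffOn p.1 hp.1).eq
    (hΨ.hasMFDerivWithinAt hp.1 p.2) (h1.comp p.1 h2 hmem)
  have h4 := DFunLike.congr_fun h3 (1 : ℝ)
  refine congrArg (α (Ψ p.1 p.2)) (Eq.trans ?_ h4)
  exact (one_smul ℝ (isotopyVelocity Ψ p.1 p.2)).symm

/-- Composition of a time-reversed contact isotopy with a reparametrized Reeb flow. -/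
lemma IsContactIsotopy.reeb_comp_reverse [IsManifold (𝓡 (2 * n + 1)) ∞ N] [T2Space N]
    [CompactSpace N] (hα : IsContactForm α)
    {Θ : ℝ → N ≃ₘ⟮𝓡 (2 * n + 1), 𝓡 (2 * n + 1)⟯ N} (hΘ : IsContactIsotopy α Θ)
    {χ : N ≃ₘ⟮𝓡 (2 * n + 1), 𝓡 (2 * n + 1)⟯ N} (hχ : IsContactomorphism α χ)
    {b : ℝ → ℝ} (hb : ContDiff ℝ ∞ b)
    (h0 : χ.trans ((Θ 1).trans (reebFlow α (b 0))) = Diffeomorph.refl (𝓡 (2 * n + 1)) N ∞) :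
    IsContactIsotopy α (fun t ↦ χ.trans ((Θ (1 - t)).trans (reebFlow α (b t)))) where
  smooth := by
    have h1 : ContMDiffOn (𝓘(ℝ, ℝ).prod (𝓡 (2 * n + 1))) (𝓡 (2 * n + 1)) ∞
        (fun p : ℝ × N ↦ Θ (1 - p.1) (χ p.2)) (Icc 0 1 ×ˢ univ) := by
      have h2 : ContMDiff (𝓘(ℝ, ℝ).prod (𝓡 (2 * n + 1))) 𝓘(ℝ, ℝ) ∞
          (fun p : ℝ × N ↦ 1 - p.1) := contMDiff_const.sub contMDiff_fst
      have h3 : ContMDiff (𝓘(ℝ, ℝ).prod (𝓡 (2 * n + 1))) (𝓘(ℝ, ℝ).prod (𝓡 (2 * n + 1))) ∞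
          (fun p : ℝ × N ↦ (1 - p.1, χ p.2)) := h2.prodMk (χ.contMDiff.comp contMDiff_snd)
      exact hΘ.smooth.comp h3.contMDiffOn
        fun p hp ↦ ⟨⟨by linarith [hp.1.2], by linarith [hp.1.1]⟩, mem_univ _⟩
    exact (reebFlow_isFlow hα).1.comp_contMDiffOn
      ((hb.contMDiff.comp contMDiff_fst).contMDiffOn.prodMk h1)
  contact := fun t ht ↦ hχ.trans ((hΘ.contact _ ⟨by linarith [ht.2], by linarith [ht.1]⟩).trans
    (isContactomorphism_reebFlow hα _))
  zero := by simpa using h0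

/-- By the chain rule the velocity is `b' R` plus the image of `-V` under the differential of
`φ_R^{b(t)}`, where `V` is the velocity of `Θ` at time `1 - t`. The first term pairs to `b'` because
`α(R) = 1`, the second to `-α(V)` because the Reeb flow preserves `α`. -/
lemma isotopyPairing_reeb_comp_reverse [IsManifold (𝓡 (2 * n + 1)) ∞ N] [T2Space N]
    [CompactSpace N] (hα : IsContactForm α)
    {Θ : ℝ → N ≃ₘ⟮𝓡 (2 * n + 1), 𝓡 (2 * n + 1)⟯ N} (hΘ : IsContactIsotopy α Θ)
    (χ : N ≃ₘ⟮𝓡 (2 * n + 1), 𝓡 (2 * n + 1)⟯ N) {b : ℝ → ℝ} {b' t : ℝ}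
    (hb : HasDerivAt b b' t) (ht : t ∈ Icc (0 : ℝ) 1) (x : N) :
    isotopyPairing α (fun t ↦ χ.trans ((Θ (1 - t)).trans (reebFlow α (b t)))) t x =
      b' - isotopyPairing α Θ (1 - t) (χ x) := by
  obtain ⟨hφ, hφ0, hφadd, hφR⟩ := reebFlow_isFlow hα
  have ht' : 1 - t ∈ Icc (0 : ℝ) 1 := ⟨by linarith [ht.2], by linarith [ht.1]⟩
  set Φ : ℝ × N → N := fun p ↦ reebFlow α p.1 p.2
  let z : N := Θ (1 - t) (χ x)
  let V : TangentSpace (𝓡 (2 * n + 1)) z := isotopyVelocity Θ (1 - t) (χ x)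
  have hΦ : MDifferentiableAt (𝓘(ℝ, ℝ).prod (𝓡 (2 * n + 1))) (𝓡 (2 * n + 1)) Φ (b t, z) :=
    hφ.mdifferentiable (by simp) _
  have hrev : HasMFDerivWithinAt 𝓘(ℝ, ℝ) 𝓘(ℝ, ℝ) (fun s : ℝ ↦ 1 - s) (Icc 0 1) t
      ((1 : ℝ →L[ℝ] ℝ).smulRight (-1 : ℝ)) :=
    ((hasDerivAt_id t).const_sub 1).hasFDerivAt.hasMFDerivAt.hasMFDerivWithinAt
  have hc := (hΘ.hasMFDerivWithinAt ht' (χ x)).comp t hrev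
    (fun s hs ↦ ⟨by linarith [hs.2], by linarith [hs.1]⟩)
  have hbm := hb.hasFDerivAt.hasMFDerivAt.hasMFDerivWithinAt (s := Icc (0 : ℝ) 1)
  have hcomp := hΦ.hasMFDerivAt.comp_hasMFDerivWithinAt t (hbm.prodMk hc)
  have hvel : isotopyVelocity (fun t ↦ χ.trans ((Θ (1 - t)).trans (reebFlow α (b t)))) t x =
      mfderiv (𝓘(ℝ, ℝ).prod (𝓡 (2 * n + 1))) (𝓡 (2 * n + 1)) Φ (b t, z) (b', -V) := by
    have h1 := DFunLike.congr_fun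
      (hcomp.mfderivWithin (uniqueDiffOn_Icc_zero_one.uniqueMDiffOn t ht)) (1 : ℝ)
    refine h1.trans (congrArg (mfderiv (𝓘(ℝ, ℝ).prod (𝓡 (2 * n + 1))) (𝓡 (2 * n + 1)) Φ (b t, z))
      (Prod.ext (one_smul ℝ b') ?_))
    change ((1 : ℝ →L[ℝ] ℝ) (((1 : ℝ →L[ℝ] ℝ) 1) • (-1 : ℝ))) • V = -V
    simp
  let W : OddModel n := (-V : TangentSpace (𝓡 (2 * n + 1)) z)
  have hsplit : isotopyVelocity (fun t ↦ χ.trans ((Θ (1 - t)).trans (reebFlow α (b t)))) t x =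
      mfderiv 𝓘(ℝ, ℝ) (𝓡 (2 * n + 1)) (fun s ↦ Φ (s, z)) (b t) b' +
        mfderiv (𝓡 (2 * n + 1)) (𝓡 (2 * n + 1)) (fun y ↦ Φ (b t, y)) z W :=
    hvel.trans (mfderiv_prod_eq_add_apply hΦ (v := ((b', W) : ℝ × OddModel n)))
  have h1 : mfderiv 𝓘(ℝ, ℝ) (𝓡 (2 * n + 1)) (fun s ↦ Φ (s, z)) (b t) b' =
      b' • reebField α (reebFlow α (b t) z) := by
    rw [(hφR z (b t)).mfderiv]
    rfl
  have h2 : α (reebFlow α (b t) z)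
      (mfderiv 𝓘(ℝ, ℝ) (𝓡 (2 * n + 1)) (fun s ↦ Φ (s, z)) (b t) b') = b' := by
    rw [h1]
    refine (map_smul (α (reebFlow α (b t) z)) b' _).trans ?_
    rw [(reebField_spec hα _).1, smul_eq_mul, mul_one]
  have h3 : α (reebFlow α (b t) z)
      (mfderiv (𝓡 (2 * n + 1)) (𝓡 (2 * n + 1)) (fun y ↦ Φ (b t, y)) z W) = -α z V :=
    (pairing_mfderiv_reebFlow hα (b t) z (-V)).trans (map_neg (α z) V)
  refine (congrArg (α (reebFlow α (b t) z)) hsplit).trans ?_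
  refine (map_add (α (reebFlow α (b t) z)) _ _).trans ?_
  rw [sub_eq_add_neg]
  exact congrArg₂ (· + ·) h2 h3

end ReebTimeMaps

/-! ### Energy estimates in both directions. -/

section Energy

open Set

/-- Supplies the integrability of the energy integrands, without which the integrals could not be
compared by monotonicity. -/
lemma continuousOn_iSup_of_compact {X : Type*} [TopologicalSpace X] [CompactSpace X]
    {K : ℝ → X → ℝ} {s : Set ℝ}
    (hK : ContinuousOn (fun p : ℝ × X ↦ K p.1 p.2) (s ×ˢ univ)) :
    ContinuousOn (fun t ↦ ⨆ x, K t x) s := by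
  rw [continuousOn_iff_continuous_domRestrict]
  have h1 : Continuous fun p : s × X ↦ K p.1 p.2 :=
    hK.comp_continuous ((continuous_subtype_val.comp continuous_fst).prodMk continuous_snd)
      fun p ↦ ⟨p.1.2, mem_univ _⟩
  have h2 := isCompact_univ.continuous_sSup (f := fun (t : s) x ↦ K t x) h1
  simp only [image_univ] at h2
  exact h2

lemma continuousOn_iInf_of_compact {X : Type*} [TopologicalSpace X] [CompactSpace X]
    {K : ℝ → X → ℝ} {s : Set ℝ}
    (hK : ContinuousOn (fun p : ℝ × X ↦ K p.1 p.2) (s ×ˢ univ)) :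
    ContinuousOn (fun t ↦ ⨅ x, K t x) s := by
  rw [continuousOn_iff_continuous_domRestrict]
  have h1 : Continuous fun p : s × X ↦ K p.1 p.2 :=
    hK.comp_continuous ((continuous_subtype_val.comp continuous_fst).prodMk continuous_snd)
      fun p ↦ ⟨p.1.2, mem_univ _⟩
  have h2 := isCompact_univ.continuous_sInf (f := fun (t : s) x ↦ K t x) h1
  simp only [image_univ] at h2
  exact h2

/-- Approximation of a continuous function by the derivative of a smooth one. -/
lemma exists_contDiff_hasDerivAt_near {c : ℝ → ℝ} (hc : ContinuousOn c (Icc 0 1)) {ε : ℝ}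
    (hε : 0 < ε) :
    ∃ b b' : ℝ → ℝ, ContDiff ℝ ∞ b ∧ b 0 = 0 ∧ (∀ t, HasDerivAt b (b' t) t) ∧
      ∀ t ∈ Icc (0 : ℝ) 1, |b' t - c t| < ε := by
  -- By Weierstrass approximation, `b` can be the primitive of a polynomial.
  obtain ⟨p, hp⟩ := exists_polynomial_near_of_continuousOn 0 1 c hc ε hε
  have hd : ∀ t, HasDerivAt (fun t ↦ ∫ s in (0 : ℝ)..t, p.eval s) (p.eval t) t := fun t ↦
    (p.continuous.integral_hasStrictDerivAt 0 t).hasDerivAt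
  refine ⟨_, fun t ↦ p.eval t, ?_, by simp, hd, hp⟩
  rw [contDiff_infty_iff_deriv]
  refine ⟨fun t ↦ (hd t).differentiableAt, ?_⟩
  rw [funext fun t ↦ (hd t).deriv]
  have h := Polynomial.contDiff_aeval (𝕜 := ℝ) p ∞
  simp only [Polynomial.coe_aeval_eq_eval] at h
  exact h

variable {n : ℕ} {N : Type*} [TopologicalSpace N] [ChartedSpace (OddModel n) N]
  {α : ∀ x : N, TangentSpace (𝓡 (2 * n + 1)) x →L[ℝ] ℝ}
  {Ψ : ℝ → N ≃ₘ⟮𝓡 (2 * n + 1), 𝓡 (2 * n + 1)⟯ N}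

lemma hoferEnergy_le (hΨ : IsContactIsotopy α Ψ) :
    hoferEnergy α (Ψ 1) ≤ ∫ t in (0 : ℝ)..1, ⨆ x, |isotopyPairing α Ψ t x| := by
  refine csInf_le ⟨0, ?_⟩ ⟨Ψ, hΨ, rfl, by simp only [iSup_abs_contactHamiltonian]⟩
  rintro _ ⟨Θ, -, -, rfl⟩
  exact intervalIntegral.integral_nonneg zero_le_one fun t _ ↦
    Real.iSup_nonneg fun _ ↦ abs_nonneg _

lemma hoferEnergy_nonneg (α : ∀ x : N, TangentSpace (𝓡 (2 * n + 1)) x →L[ℝ] ℝ)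
    (ψ : N ≃ₘ⟮𝓡 (2 * n + 1), 𝓡 (2 * n + 1)⟯ N) : 0 ≤ hoferEnergy α ψ := by
  refine Real.sInf_nonneg ?_
  rintro _ ⟨Θ, -, -, rfl⟩
  exact intervalIntegral.integral_nonneg zero_le_one fun t _ ↦
    Real.iSup_nonneg fun _ ↦ abs_nonneg _

variable [IsManifold (𝓡 (2 * n + 1)) ∞ N]

lemma IsContactIsotopy.continuous_isotopyPairing (hα : IsContactForm α)
    (hΨ : IsContactIsotopy α Ψ) {t : ℝ} (ht : t ∈ Icc (0 : ℝ) 1) :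
    Continuous (isotopyPairing α Ψ t) :=
  (hΨ.continuousOn_isotopyPairing hα).comp_continuous (continuous_const.prodMk continuous_id)
    fun _ ↦ ⟨ht, mem_univ _⟩

variable [CompactSpace N]

lemma IsContactIsotopy.continuousOn_iSup_abs (hα : IsContactForm α)
    (hΨ : IsContactIsotopy α Ψ) :
    ContinuousOn (fun t ↦ ⨆ x, |isotopyPairing α Ψ t x|) (Icc 0 1) :=
  continuousOn_iSup_of_compact (hΨ.continuousOn_isotopyPairing hα).abs

lemma IsContactIsotopy.continuousOn_oscillation (hα : IsContactForm α)
    (hΨ : IsContactIsotopy α Ψ) :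
    ContinuousOn (fun t ↦ (⨆ x, isotopyPairing α Ψ t x) - ⨅ x, isotopyPairing α Ψ t x)
      (Icc 0 1) :=
  (continuousOn_iSup_of_compact (hΨ.continuousOn_isotopyPairing hα)).sub
    (continuousOn_iInf_of_compact (hΨ.continuousOn_isotopyPairing hα))

lemma oscHoferEnergy_le [Nonempty N] (hα : IsContactForm α) (hΨ : IsContactIsotopy α Ψ) :
    oscHoferEnergy α (Ψ 1) ≤ ∫ t in (0 : ℝ)..1,
      ((⨆ x, isotopyPairing α Ψ t x) - ⨅ x, isotopyPairing α Ψ t x) := by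
  refine csInf_le ⟨0, ?_⟩ ⟨Ψ, hΨ, rfl, by
    simp only [iSup_contactHamiltonian, iInf_contactHamiltonian]⟩
  rintro _ ⟨Θ, hΘ, -, rfl⟩
  refine intervalIntegral.integral_nonneg zero_le_one fun t ht ↦ ?_
  rw [iSup_contactHamiltonian, iInf_contactHamiltonian, sub_nonneg]
  have hcomp := isCompact_range (hΘ.continuous_isotopyPairing hα ht)
  exact ciInf_le_ciSup hcomp.bddBelow hcomp.bddAbove

variable [T2Space N]

lemma reebFlow_zero (hα : IsContactForm α) :
    reebFlow α 0 = Diffeomorph.refl (𝓡 (2 * n + 1)) N ∞ :=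
  Diffeomorph.ext (reebFlow_isFlow hα).2.1

/-- An isotopy to `ψ` gives, after correction by a Reeb flow, an isotopy to `φ_R^t ψ⁻¹` whose
energy is at most half of the oscillation energy, up to `ε`. -/
lemma IsContactIsotopy.exists_contactHoferDist_reebFlow_le [Nonempty N] (hα : IsContactForm α)
    (hΨ : IsContactIsotopy α Ψ) {ε : ℝ} (hε : 0 < ε) :
    ∃ t, contactHoferDist α (Ψ 1) (reebFlow α t) ≤ ε + 1 / 2 * ∫ t in (0 : ℝ)..1,
      ((⨆ x, isotopyPairing α Ψ t x) - ⨅ x, isotopyPairing α Ψ t x) := by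
  set S : ℝ → ℝ := fun t ↦ ⨆ x, isotopyPairing α Ψ t x with hS
  set J : ℝ → ℝ := fun t ↦ ⨅ x, isotopyPairing α Ψ t x with hJ
  have hSc : ContinuousOn S (Icc 0 1) :=
    continuousOn_iSup_of_compact (hΨ.continuousOn_isotopyPairing hα)
  have hJc : ContinuousOn J (Icc 0 1) :=
    continuousOn_iInf_of_compact (hΨ.continuousOn_isotopyPairing hα)
  have hmaps : MapsTo (fun t : ℝ ↦ 1 - t) (Icc 0 1) (Icc 0 1) := fun t ht ↦
    ⟨by linarith [ht.2], by linarith [ht.1]⟩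
  have hrev : ContinuousOn (fun t : ℝ ↦ 1 - t) (Icc 0 1) := by fun_prop
  -- The midpoint of the range of `H_{1-t}` is the constant closest to it in sup norm, at distance
  -- half the oscillation. It is only continuous in `t`, whereas `b` must be smooth, hence the error
  -- `ε`.
  obtain ⟨b, b', hb, hb0, hbd, hbc⟩ := exists_contDiff_hasDerivAt_near
    (c := fun t ↦ (S (1 - t) + J (1 - t)) / 2)
    (((hSc.comp hrev hmaps).add (hJc.comp hrev hmaps)).div_const 2) hε
  let χ := (Ψ 1).symm
  have hχ : IsContactomorphism α χ := (hΨ.contact 1 (by simp)).symm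
  have hθ := hΨ.reeb_comp_reverse hα hχ hb (by
    rw [hb0, reebFlow_zero hα]
    exact Diffeomorph.ext fun x ↦ (Ψ 1).apply_symm_apply x)
  refine ⟨b 1, ?_⟩
  have hend : (Ψ 1).symm.trans (reebFlow α (b 1)) =
      χ.trans ((Ψ (1 - 1)).trans (reebFlow α (b 1))) := by
    rw [sub_self, hΨ.zero]
    rfl
  rw [contactHoferDist, hend]
  refine (hoferEnergy_le hθ).trans ?_
  have hint : ContinuousOn (fun t ↦ ε + 1 / 2 * (S (1 - t) - J (1 - t))) (Icc 0 1) :=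
    continuousOn_const.add (continuousOn_const.mul
      ((hSc.comp hrev hmaps).sub (hJc.comp hrev hmaps)))
  have hle : ∀ t ∈ Icc (0 : ℝ) 1, ⨆ x, |isotopyPairing α
      (fun t ↦ χ.trans ((Ψ (1 - t)).trans (reebFlow α (b t)))) t x| ≤
        ε + 1 / 2 * (S (1 - t) - J (1 - t)) := by
    intro t ht
    have hcomp := isCompact_range (hΨ.continuous_isotopyPairing hα (hmaps ht))
    refine ciSup_le fun x ↦ ?_
    rw [isotopyPairing_reeb_comp_reverse hα hΨ χ (hbd t) ht x]
    have h1 : isotopyPairing α Ψ (1 - t) (χ x) ≤ S (1 - t) := le_ciSup hcomp.bddAbove (χ x)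
    have h2 : J (1 - t) ≤ isotopyPairing α Ψ (1 - t) (χ x) := ciInf_le hcomp.bddBelow (χ x)
    have h3 := abs_lt.mp (hbc t ht)
    rw [abs_le]
    constructor <;> linarith [h3.1, h3.2]
  refine (intervalIntegral.integral_mono_on zero_le_one
    ((hθ.continuousOn_iSup_abs hα).intervalIntegrable_of_Icc zero_le_one)
    (hint.intervalIntegrable_of_Icc zero_le_one) hle).trans (le_of_eq ?_)
  have hSJ : IntervalIntegrable (fun t ↦ S t - J t) MeasureTheory.volume 0 1 :=
    (hSc.sub hJc).intervalIntegrable_of_Icc zero_le_one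
  rw [intervalIntegral.integral_comp_sub_left (fun t ↦ ε + 1 / 2 * (S t - J t)) 1, sub_self,
    sub_zero, intervalIntegral.integral_add intervalIntegrable_const
      (hSJ.const_mul _),
    intervalIntegral.integral_const, intervalIntegral.integral_const_mul]
  simp [S, J]

/-- A path `Φ` to `φ_R^s ψ⁻¹` yields the path `φ_R^{st-s} ∘ Φ_{1-t} ∘ ψ` to `ψ`. Its pulled-back
Hamiltonian takes values within `max |H_{1-t}|` of `s`, where `H` is the Hamiltonian of `Φ`, so its
oscillation is at most twice that. -/
lemma half_oscHoferEnergy_le_contactHoferDist [Nonempty N] (hα : IsContactForm α)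
    {ψ : N ≃ₘ⟮𝓡 (2 * n + 1), 𝓡 (2 * n + 1)⟯ N} (hψ : ψ ∈ Cont₀ α) (s : ℝ) :
    1 / 2 * oscHoferEnergy α ψ ≤ contactHoferDist α ψ (reebFlow α s) := by
  obtain ⟨Ψ, hΨ, rfl⟩ := hψ
  have hflow := reebFlow_isFlow hα
  have hcont : IsContactomorphism α (Ψ 1) := hΨ.contact 1 (by simp)
  have hmaps : MapsTo (fun t : ℝ ↦ 1 - t) (Icc 0 1) (Icc 0 1) := fun t ht ↦
    ⟨by linarith [ht.2], by linarith [ht.1]⟩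
  refine le_csInf ?_ ?_
  -- Some isotopy to `φ_R^s ψ⁻¹` must exist, since the infimum of the empty set would be the default
  -- value `0`.
  · have hθ := hΨ.reeb_comp_reverse hα hcont.symm (b := fun t ↦ s * t) (by fun_prop) (by
      rw [mul_zero, reebFlow_zero hα]
      exact Diffeomorph.ext fun x ↦ (Ψ 1).apply_symm_apply x)
    refine ⟨_, _, hθ, ?_, rfl⟩
    rw [sub_self, hΨ.zero, mul_one]
    rfl
  · rintro _ ⟨Φ, hΦ, hΦ1, rfl⟩
    simp only [iSup_abs_contactHamiltonian]
    -- The value `b 0 = -s` cancels the factor `φ_R^s` in the endpoint of `Φ`, and `b 1 = 0` makes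
    -- the new path end at `ψ`.
    let b : ℝ → ℝ := fun t ↦ s * t - s
    have hb : ∀ t, HasDerivAt b s t := fun t ↦
      (((hasDerivAt_id t).const_mul s).sub_const s).congr_deriv (mul_one s)
    have hθ := hΦ.reeb_comp_reverse hα hcont (b := b) (by fun_prop) (by
      rw [hΦ1]
      refine Diffeomorph.ext fun x ↦ ?_
      change reebFlow α (s * 0 - s) (reebFlow α s ((Ψ 1).symm (Ψ 1 x))) = x
      rw [← hflow.2.2.1, (Ψ 1).symm_apply_apply]
      simp [hflow.2.1])
    have hend : (Ψ 1).trans ((Φ (1 - 1)).trans (reebFlow α (b 1))) = Ψ 1 := by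
      have hb1 : b 1 = 0 := by simp [b]
      rw [sub_self, hΦ.zero, hb1, reebFlow_zero hα]
      rfl
    have hosc := oscHoferEnergy_le hα hθ
    rw [hend] at hosc
    have hint := hΦ.continuousOn_iSup_abs hα
    have hle : ∀ t ∈ Icc (0 : ℝ) 1,
        (⨆ x, isotopyPairing α (fun t ↦ (Ψ 1).trans ((Φ (1 - t)).trans (reebFlow α (b t)))) t x) -
        (⨅ x, isotopyPairing α (fun t ↦ (Ψ 1).trans ((Φ (1 - t)).trans (reebFlow α (b t)))) t x) ≤
          2 * ⨆ x, |isotopyPairing α Φ (1 - t) x| := by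
      intro t ht
      have hcomp := isCompact_range (hΦ.continuous_isotopyPairing hα (hmaps ht)).abs
      have hx : ∀ x, |isotopyPairing α Φ (1 - t) (Ψ 1 x)| ≤
          ⨆ x, |isotopyPairing α Φ (1 - t) x| := fun x ↦ le_ciSup hcomp.bddAbove (Ψ 1 x)
      have h1 : (⨆ x, isotopyPairing α
          (fun t ↦ (Ψ 1).trans ((Φ (1 - t)).trans (reebFlow α (b t)))) t x) ≤
          s + ⨆ x, |isotopyPairing α Φ (1 - t) x| := ciSup_le fun x ↦ by
        rw [isotopyPairing_reeb_comp_reverse hα hΦ (Ψ 1) (hb t) ht x]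
        linarith [(abs_le.mp (hx x)).1]
      have h2 : s - (⨆ x, |isotopyPairing α Φ (1 - t) x|) ≤ ⨅ x, isotopyPairing α
          (fun t ↦ (Ψ 1).trans ((Φ (1 - t)).trans (reebFlow α (b t)))) t x :=
        le_ciInf fun x ↦ by
          rw [isotopyPairing_reeb_comp_reverse hα hΦ (Ψ 1) (hb t) ht x]
          linarith [(abs_le.mp (hx x)).2]
      linarith
    have hrev : ContinuousOn (fun t : ℝ ↦ 1 - t) (Icc 0 1) := by fun_prop
    have hbound : ContinuousOn (fun t ↦ 2 * ⨆ x, |isotopyPairing α Φ (1 - t) x|) (Icc 0 1) :=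
      continuousOn_const.mul (hint.comp hrev hmaps)
    have hmono := intervalIntegral.integral_mono_on (μ := MeasureTheory.volume) zero_le_one
      ((hθ.continuousOn_oscillation hα).intervalIntegrable_of_Icc zero_le_one)
      (hbound.intervalIntegrable_of_Icc zero_le_one) hle
    rw [intervalIntegral.integral_comp_sub_left
      (fun t ↦ 2 * ⨆ x, |isotopyPairing α Φ t x|) 1, sub_self, sub_zero,
      intervalIntegral.integral_const_mul] at hmono
    linarith

end Energy

theorem mainTheorem4 {n : ℕ} {N : Type*} [TopologicalSpace N] [ChartedSpace (OddModel n) N]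
    [IsManifold (𝓡 (2 * n + 1)) ∞ N] [T2Space N] [CompactSpace N] [ConnectedSpace N]
    (α : ∀ x : N, TangentSpace (𝓡 (2 * n + 1)) x →L[ℝ] ℝ) (hα : IsContactForm α)
    (ψ : N ≃ₘ⟮𝓡 (2 * n + 1), 𝓡 (2 * n + 1)⟯ N) (hψ : ψ ∈ Cont₀ α) :
    1 / 2 * oscHoferEnergy α ψ = contactHoferDistToSet α ψ (reebSubgroup α) ∧
    contactHoferDistToSet α ψ (reebSubgroup α) =
      ⨅ t : ℝ, contactHoferDist α ψ (reebFlow α t) := by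
  have hset : contactHoferDistToSet α ψ (reebSubgroup α) =
      ⨅ t : ℝ, contactHoferDist α ψ (reebFlow α t) := by
    rw [contactHoferDistToSet, reebSubgroup, ← Set.range_comp]
    rfl
  refine ⟨?_, hset⟩
  rw [hset]
  refine le_antisymm (le_ciInf fun t ↦ half_oscHoferEnergy_le_contactHoferDist hα hψ t) ?_
  have hbdd : BddBelow (Set.range fun t : ℝ ↦ contactHoferDist α ψ (reebFlow α t)) :=
    ⟨0, by rintro _ ⟨t, rfl⟩; exact hoferEnergy_nonneg α _⟩
  suffices h : 2 * ⨅ t : ℝ, contactHoferDist α ψ (reebFlow α t) ≤ oscHoferEnergy α ψ by linarith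
  refine le_csInf ?_ ?_
  · obtain ⟨Ψ, hΨ, hΨ1⟩ := hψ
    exact ⟨_, Ψ, hΨ, hΨ1, rfl⟩
  · rintro _ ⟨Ψ, hΨ, rfl, rfl⟩
    simp only [iSup_contactHamiltonian, iInf_contactHamiltonian]
    refine le_of_forall_pos_le_add fun ε hε ↦ ?_
    -- The error is halved because the estimate is multiplied by `2`.
    obtain ⟨t, ht⟩ := hΨ.exists_contactHoferDist_reebFlow_le hα (half_pos hε)
    have := (ciInf_le hbdd t).trans ht
    linarith
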